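/- Let $M\subset\mathbb R^3$ be a compact convex set with non-empty interior, let $v_-<v_+$ be the minimum and maximum of the coordinate $z$ on $M$, and suppose that $B:=\partial M\cap\{v_-<z<v_+\}$ is a smooth surface. Let $X$ be the Euclidean outward unit normal of $\partial M$ and let $\bar\rho\in[0,\pi]$ be the function on $\partial M$ with $\cos\bar\rho=\langle X,\partial/\partial z\rangle_{g_{Eucl}}$. Let $g$ be a Riemannian metric on $M$ which is smooth on $M\cap\{v_-<z<v_+\}$, and denote by $H$ and $H_0$ the mean curvatures of $\partial M$ with respect to $g$ and $g_{Eucl}$, taken with the outward unit normals (so that the Euclidean unit sphere has mean curvature $2$). Assume that on $B$ one has $H\ge 0$ and $$H^2 g\ \ge\ H_0^2\, g_{Eucl}\qquad\text{as quadratic forms on } T(\partial M).$$ Let $\gamma$ be a regular simple closed curve of class $C^1$ contained in $B$ which separates $\partial M\cap\{z=v_-\}$ and $\partial M\cap\{z=v_+\}$ (that is, no connected component of $\partial M\setminus\gamma$ meets both sets), and let $\nu$ be a continuous $g$-unit normal vector field of $\gamma$ in $\partial M$ (either of the two). Then $$\int_\gamma \frac{1}{\sin\bar\rho}\,\bigl(H-\nabla_\nu\bar\rho\bigr)\,ds\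 \ge\ 2\pi ,$$ where $ds$ is the arc length element of $g$. In particular, this holds when $\gamma$ is such a boundary component of a surface $\Sigma\subset M$ that is the relative boundary of a minimizer $\Omega$ of the capillary functional $A^{\bar\rho}(\Omega)=|\partial\Omega\cap\operatorname{int}M|_g-\int_{\partial\Omega\cap\partial M}\cos\bar\rho\,d\mathcal H^2_g$, with $\nu$ the normal of $\gamma$ in $\partial M$ pointing out of $\Omega$. -/

import Mathlib

open scoped RealInnerProductSpace ContDiff
open Set

/-- Euclidean three-space, with coordinates `x = p 0`, `y = p 1`, `z = p 2`. -/
abbrev Space3 : Type := EuclideanSpace ℝ (Fin 3)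

/-- A field of bilinear forms on (a part of) `ℝ³`, `g p v w = ⟨v, w⟩_{g(p)}`. -/
abbrev BilinField : Type := Space3 → Space3 →L[ℝ] Space3 →L[ℝ] ℝ

/-- The Euclidean metric. -/
noncomputable def euclMetric : BilinField := fun _ => innerSL ℝ

/-- `g` is a smooth Riemannian metric on the set `S` (smooth up to those boundary points
of `S` that belong to `S`). -/
structure IsRiemMetricOn (g : BilinField) (S : Set Space3) : Prop where
  smooth : ContDiffOn ℝ ∞ g S
  symm : ∀ p ∈ S, ∀ v w : Space3, g p v w = g p w v
  pos : ∀ p ∈ S, ∀ v : Space3, v ≠ 0 → 0 < g p v v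

/-- The open slab `{a < z < b}`. -/
def openSlab (a b : ℝ) : Set Space3 := {p | a < p 2 ∧ p 2 < b}

/-- Near `p` the set `M` is the sublevel set of a smooth function without critical point at `p`:
the boundary of `M` is a smooth surface near the boundary point `p`. -/
def SmoothBoundaryAt (M : Set Space3) (p : Space3) : Prop :=
  ∃ (U : Set Space3) (f : Space3 → ℝ), IsOpen U ∧ p ∈ U ∧ ContDiffOn ℝ ∞ f U ∧
    f p = 0 ∧ fderiv ℝ f p ≠ 0 ∧ M ∩ U = {x ∈ U | f x ≤ 0}

/-- The Euclidean outward unit normal of the convex body `M` at a boundary point `p`: the unit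
vector `X` with `⟨X, q - p⟩ ≤ 0` for all `q ∈ M`. It is unique where the boundary is smooth. -/
noncomputable def outerNormal (M : Set Space3) (p : Space3) : Space3 :=
  Classical.epsilon fun X : Space3 => ‖X‖ = 1 ∧ ∀ q ∈ M, ⟪X, q - p⟫ ≤ 0

/-- The tangent plane `T_p ∂M`, as a linear subspace of `ℝ³`. -/
noncomputable def bdryTangent (M : Set Space3) (p : Space3) : Submodule ℝ Space3 :=
  (ℝ ∙ outerNormal M p)ᗮ

/-- The contact angle function `ρ̄ ∈ [0, π]` on `∂M`, `cos ρ̄ = ⟨X, ∂/∂z⟩_{Eucl}`. -/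
noncomputable def contactAngle (M : Set Space3) (p : Space3) : ℝ :=
  Real.arccos ⟪outerNormal M p, EuclideanSpace.single 2 (1 : ℝ)⟫

/-- The derivative `∇_v φ` of a map `φ` defined on `∂M` in a direction `v ∈ T_p ∂M`. (The values
of the derivative within `∂M` on tangent vectors are uniquely determined.) -/
noncomputable def bdryDeriv {F : Type*} [NormedAddCommGroup F] [NormedSpace ℝ F]
    (M : Set Space3) (φ : Space3 → F) (p v : Space3) : F :=
  fderivWithin ℝ φ (frontier M) p v

/-- The outward unit normal of `∂M` with respect to the metric `g`: the `g`-gradient direction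
dual to the Euclidean normal covector, normalised to `g`-length one. -/
noncomputable def gNormal (M : Set Space3) (g : BilinField) (p : Space3) : Space3 :=
  (Real.sqrt (g p ((g p).inverse (innerSL ℝ (outerNormal M p)))
      ((g p).inverse (innerSL ℝ (outerNormal M p)))))⁻¹ •
    (g p).inverse (innerSL ℝ (outerNormal M p))

/-- The Christoffel term `Γ_p(v, w)` of the Levi-Civita connection of `g` on `M`, given by
`⟨Γ(v, w), z⟩_g = (D_v g(w, z) + D_w g(v, z) - D_z g(v, w)) / 2`. -/
noncomputable def christoffel (M : Set Space3) (g : BilinField) (p v w : Space3) : Space3 :=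
  (g p).inverse ((1 / 2 : ℝ) •
    (fderivWithin ℝ g M p v w + fderivWithin ℝ g M p w v -
      ((fderivWithin ℝ g M p).flip v).flip w))

/-- The covariant derivative `∇_v Y` at `p`, in the direction `v ∈ T_p ∂M`, of a vector field `Y`
along `∂M`. -/
noncomputable def covDeriv (M : Set Space3) (g : BilinField) (Y : Space3 → Space3)
    (p v : Space3) : Space3 :=
  bdryDeriv M Y p v + christoffel M g p v (Y p)

/-- The `g`-orthogonal projection of `ℝ³` onto `T_p ∂M`. -/
noncomputable def tangProj (M : Set Space3) (g : BilinField) (p w : Space3) : Space3 :=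
  w - g p w (gNormal M g p) • gNormal M g p

/-- The mean curvature of `∂M` with respect to `g` and the outward unit normal: the divergence
along `∂M` of the `g`-unit normal, that is the trace of `w ↦ ∇_{proj w} N`, which is the trace on
`T_p ∂M` of the shape operator. The unit sphere in Euclidean space has mean curvature `2`. -/
noncomputable def meanCurv (M : Set Space3) (g : BilinField) (p : Space3) : ℝ :=
  ∑ i : Fin 3, covDeriv M g (gNormal M g) p
    (tangProj M g p (EuclideanSpace.single i (1 : ℝ))) i

/-- `γ` is a parametrisation, by one period, of a regular simple closed curve of class `C¹`. -/
structure IsSimpleClosedCurve (γ : ℝ → Space3) : Prop where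
  contDiff : ContDiff ℝ 1 γ
  periodic : Function.Periodic γ 1
  regular : ∀ t, deriv γ t ≠ 0
  simple : InjOn γ (Ico 0 1)

/-- `K` separates `A` and `B` in `S`: no connected subset of `S \ K` meets both `A` and `B`. -/
def SeparatesIn (S K A B : Set Space3) : Prop :=
  ∀ C : Set Space3, C ⊆ S \ K → IsPreconnected C → ¬ ((C ∩ A).Nonempty ∧ (C ∩ B).Nonempty)

/-- `ν` is a continuous field of `g`-unit vectors along the closed curve `γ` that are tangent to
`∂M` and `g`-orthogonal to `γ`; it is one of the two `g`-unit normal fields of `γ` in `∂M`. -/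
structure IsUnitConormal (M : Set Space3) (g : BilinField) (γ ν : ℝ → Space3) : Prop where
  continuousOn : ContinuousOn ν (Icc 0 1)
  tangent : ∀ t ∈ Icc (0 : ℝ) 1, ν t ∈ bdryTangent M (γ t)
  orthogonal : ∀ t ∈ Icc (0 : ℝ) 1, g (γ t) (ν t) (deriv γ t) = 0
  unit : ∀ t ∈ Icc (0 : ℝ) 1, g (γ t) (ν t) (ν t) = 1

/-- The integral `∫_γ h ds` of a function `h` of the parameter along the closed curve `γ`, with
respect to `g`-arc length. -/
noncomputable def curveIntegral1 (g : BilinField) (γ : ℝ → Space3) (h : ℝ → ℝ) : ℝ :=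
  ∫ t in (0 : ℝ)..1, h t * Real.sqrt (g (γ t) (deriv γ t) (deriv γ t))

/-! Let `X` be the Euclidean normal along `γ` and `Z` its horizontal part. Strictly between the
extreme heights `X` is never vertical, so `Z` is a closed curve in the punctured plane. The
integrand dominates the angular speed of `Z` in both orientations, and `Z` has nonzero winding
number; hence the integral is at least `2π`.

Pointwise bound (`angular_speed_le`). Let `S` be the Euclidean shape operator `dX`, and let `a`, `b`
be the unit vectors of the tangent plane in the directions of increasing polar angle and azimuth of
`X`. Then `∇_ν ρ̄ = ⟪S ν, a⟫`, and `⟪S T, b⟫` is `sin ρ̄` times the angular speed of `Z` in the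
direction `T`. For `T` a `g`-unit tangent of `γ`, the claim becomes `⟪S ν, a⟫ + ⟪S T, b⟫ ≤ H`. The
left side is the trace of `S A`, where `A` sends `a, b` to `ν, T`. Convexity makes `S` positive
semidefinite, so this trace is at most `‖A‖ tr S = ‖A‖ H₀`; since `A` takes a Euclidean orthonormal
frame to a `g`-orthonormal one, the metric comparison says precisely that `H₀ ‖A‖ ≤ H`.

Winding. Were the integral smaller than `2π`, `Z` would have a continuous logarithm that closes up
(`exists_closed_log`). The horizontal displacement `w` of `γ` from an axis of interior points
satisfies `Re (w / Z) > 0`, because `X` is an outward normal; so `w` would have a closed logarithm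
too. This contradicts separation (`not_exists_log_of_separatesIn`): the logarithm would allow `w` to
be modified on the lower side of `γ` to a nonvanishing function on a disc, whose boundary values are
positive multiples of `z`. The argument needs no Jordan curve theorem. -/

/-- The horizontal part of a vector, as a complex number. -/
noncomputable def horiz (p : Space3) : ℂ := ⟨p 0, p 1⟩

theorem contDiff_horiz {k : WithTop ℕ∞} : ContDiff ℝ k horiz := by
  have h : horiz = fun p : Space3 => (p 0 : ℂ) + (p 1 : ℂ) * Complex.I := by
    funext p; exact Complex.mk_eq_add_mul_I _ _
  rw [h]
  have h0 : ∀ i : Fin 3, ContDiff ℝ k fun p : Space3 => (p i : ℂ) := fun i =>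
    Complex.ofRealCLM.contDiff.comp (EuclideanSpace.proj (𝕜 := ℝ) i).contDiff
  exact (h0 0).add ((h0 1).mul contDiff_const)

theorem continuous_horiz : Continuous horiz := (contDiff_horiz (k := 0)).continuous

theorem hasDerivAt_horiz {X : ℝ → Space3} {X' : Space3} {t : ℝ} (h : HasDerivAt X X' t) :
    HasDerivAt (fun s => horiz (X s)) (horiz X') t := by
  have h0 : ∀ i : Fin 3, HasDerivAt (fun s => (X s i : ℂ)) (X' i : ℂ) t := fun i =>
    ((EuclideanSpace.proj (𝕜 := ℝ) i).hasFDerivAt.comp_hasDerivAt t h).ofReal_comp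
  have h1 := (h0 0).add ((h0 1).mul_const Complex.I)
  have e : ∀ p : Space3, horiz p = (p 0 : ℂ) + (p 1 : ℂ) * Complex.I := fun p =>
    Complex.mk_eq_add_mul_I _ _
  simp only [e]
  exact h1

theorem eq_of_horiz_sub_eq_zero {p q : Space3} (h : horiz (p - q) = 0) (h2 : p 2 = q 2) :
    p = q := by
  have h0 := congrArg Complex.re h
  have h1 := congrArg Complex.im h
  simp only [horiz, PiLp.sub_apply, Complex.zero_re, Complex.zero_im] at h0 h1
  ext i
  fin_cases i
  · exact sub_eq_zero.mp h0
  · exact sub_eq_zero.mp h1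
  · exact h2

/-! ### Topology: a separating set winds around an interior axis -/

/-- A nonvanishing function on the plane is not a positive multiple of the identity on the unit
circle. -/
theorem not_pos_smul_id_on_circle (F : ℂ → ℂ) (hF : Continuous F) (hF0 : ∀ z, F z ≠ 0)
    (hF1 : ∀ z : ℂ, ‖z‖ = 1 → ∃ r : ℝ, 0 < r ∧ F z = r * z) : False := by
  obtain ⟨L, ⟨-, hL⟩, -⟩ := Complex.isCoveringMapOn_exp.existsUnique_continuousMap_lifts
    (⟨F, hF⟩ : C(ℂ, ℂ)) (a₀ := 0) (e₀ := Complex.log (F 0))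
    (by simpa using Complex.exp_log (hF0 0)) (by simpa using hF0)
  have hL' : ∀ z, Complex.exp (L z) = F z := fun z => congrFun hL z
  -- Both sides lift the same loop in the circle through `Circle.exp` and agree at `0`. The left
  -- side is `2π`-periodic and the right side is not.
  have key : (fun t : ℝ => (L (Circle.exp t : ℂ)).im) = fun t => t + (L 1).im := by
    refine Circle.isCoveringMap_exp.eq_of_comp_eq (by fun_prop) (by fun_prop) ?_ 0 (by simp)
    funext t
    apply Circle.ext
    have hone : Complex.exp (((L 1).im : ℂ) * Complex.I) = 1 := by
      obtain ⟨r, hr, h⟩ := hF1 1 (by simp)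
      rw [← hL', ← Complex.re_add_im (L 1), Complex.exp_add, mul_one] at h
      have hn := congrArg norm h
      rw [norm_mul, Complex.norm_exp_ofReal_mul_I, mul_one, ← Complex.ofReal_exp,
        Complex.norm_real, Complex.norm_real, Real.norm_of_nonneg (Real.exp_pos _).le,
        Real.norm_of_nonneg hr.le] at hn
      rw [← Complex.ofReal_exp, hn] at h
      exact mul_left_cancel₀ (Complex.ofReal_ne_zero.mpr hr.ne') (by rw [h, mul_one])
    obtain ⟨r, hr, h⟩ := hF1 (Circle.exp t) (by simp)
    rw [← hL', ← Complex.re_add_im (L (Circle.exp t)), Complex.exp_add] at h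
    have hn := congrArg norm h
    rw [norm_mul, Complex.norm_exp_ofReal_mul_I, mul_one, ← Complex.ofReal_exp, norm_mul,
      Circle.norm_coe, mul_one, Complex.norm_real, Complex.norm_real,
      Real.norm_of_nonneg (Real.exp_pos _).le, Real.norm_of_nonneg hr.le] at hn
    rw [← Complex.ofReal_exp, hn] at h
    have h' := mul_left_cancel₀ (Complex.ofReal_ne_zero.mpr hr.ne') h
    simp only [Function.comp_apply, Circle.coe_exp] at h' ⊢
    rw [h', Complex.ofReal_add, add_mul, Complex.exp_add, hone, mul_one]
  have h := congrFun key (2 * Real.pi)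
  simp only [Circle.exp_two_pi, Circle.coe_one] at h
  linarith [Real.pi_pos]

/-- The radial projection onto the boundary of a convex body from an interior point. -/
theorem exists_radial_projection {M : Set Space3} (hM : IsCompact M) (hconv : Convex ℝ M)
    {c : Space3} (hc : c ∈ interior M) :
    ∃ P : Space3 → Space3, ContinuousOn P {0}ᶜ ∧
      (∀ w, w ≠ 0 → P w ∈ frontier M ∧ ∃ r : ℝ, 0 < r ∧ P w = c + r • w) ∧
      ∀ p ∈ frontier M, P (p - c) = p := by
  -- With `c` moved to the origin, the boundary is the level set `1` of the gauge, and dividing by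
  -- the gauge is the projection.
  set e : Space3 ≃ₜ Space3 := Homeomorph.addLeft c with he
  set s : Set Space3 := e ⁻¹' M with hs
  have hsconv : Convex ℝ s := hconv.translate_preimage_right c
  have hs0 : s ∈ nhds (0 : Space3) := by
    refine e.continuous.continuousAt ?_
    simpa [he] using mem_interior_iff_mem_nhds.mp hc
  have hsb : Bornology.IsVonNBounded ℝ s :=
    NormedSpace.isVonNBounded_of_isBounded ℝ (by
      have : s = e.symm '' M := e.symm.image_eq_preimage_symm M |>.symm
      rw [this]; exact (hM.image e.symm.continuous).isBounded)
  have hsa : Absorbent ℝ s := absorbent_nhds_zero hs0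
  have hpos : ∀ w, w ≠ 0 → 0 < gauge s w := fun w hw => (gauge_pos hsa hsb).mpr hw
  have hfr : ∀ w, gauge s w = 1 ↔ c + w ∈ frontier M := fun w => by
    rw [gauge_eq_one_iff_mem_frontier hsconv hs0, hs, ← e.preimage_frontier]; rfl
  refine ⟨fun w => c + (gauge s w)⁻¹ • w, ?_, ?_, ?_⟩
  · have hinv : ContinuousOn (fun w => (gauge s w)⁻¹) {0}ᶜ :=
      (continuous_gauge hsconv hs0).continuousOn.inv₀ fun w hw => (hpos w hw).ne'
    exact continuousOn_const.add (hinv.smul continuousOn_id)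
  · intro w hw
    refine ⟨(hfr _).mp ?_, _, inv_pos.mpr (hpos w hw), rfl⟩
    rw [gauge_smul_of_nonneg (inv_nonneg.mpr (hpos w hw).le), smul_eq_mul,
      inv_mul_cancel₀ (hpos w hw).ne']
  · intro p hp
    have : gauge s (p - c) = 1 := (hfr _).mpr (by simpa using hp)
    simp [this]

/-- A convex body contains a continuous axis of interior points, parametrised by height. -/
theorem exists_axis {M : Set Space3} (hconv : Convex ℝ M) (hint : (interior M).Nonempty)
    {a b : ℝ} (hmin : IsLeast ((fun p : Space3 => p 2) '' M) a)
    (hmax : IsGreatest ((fun p : Space3 => p 2) '' M) b) :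
    ∃ α : ℝ → Space3, Continuous α ∧ (∀ z, α z 2 = z) ∧ a < b ∧
      ∀ z ∈ Ioo a b, α z ∈ interior M := by
  obtain ⟨c, hc⟩ := hint
  have hline : ∀ᶠ s in nhds (0 : ℝ), c + s • EuclideanSpace.single 2 (1 : ℝ) ∈ M := by
    have hcont : Continuous fun s : ℝ => c + s • (EuclideanSpace.single 2 (1 : ℝ) : Space3) := by
      fun_prop
    refine hcont.continuousAt ?_
    simpa using mem_interior_iff_mem_nhds.mp hc
  obtain ⟨ε, hε, hball⟩ := Metric.eventually_nhds_iff.mp hline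
  have hca : a < c 2 := by
    have h := hmin.2 ⟨_, hball (y := -(ε / 2))
      (by rw [Real.dist_eq, sub_zero, abs_neg, abs_of_pos (by positivity)]; linarith), rfl⟩
    simp at h; linarith
  have hcb : c 2 < b := by
    have h := hmax.2 ⟨_, hball (y := ε / 2)
      (by rw [Real.dist_eq, sub_zero, abs_of_pos (by positivity)]; linarith), rfl⟩
    simp at h; linarith
  obtain ⟨⟨q, hq, hqa⟩, -⟩ := hmin
  obtain ⟨⟨q', hq', hqb⟩, -⟩ := hmax
  simp only at hqa hqb
  have hda : c 2 - a ≠ 0 := by linarith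
  have hdb : b - c 2 ≠ 0 := by linarith
  -- The axis consists of the two rays from an interior point `c` through a highest point `q'` and a
  -- lowest point `q`. At heights strictly between `a` and `b` it stays on the half-open segments
  -- towards `q` and `q'`, hence in the interior.
  refine ⟨fun z => c + max 0 ((z - c 2) / (b - c 2)) • (q' - c) +
    max 0 ((c 2 - z) / (c 2 - a)) • (q - c), by fun_prop, fun z => ?_, hca.trans hcb, ?_⟩
  · rcases le_total z (c 2) with h | h
    · have h1 : (z - c 2) / (b - c 2) ≤ 0 :=
        div_nonpos_of_nonpos_of_nonneg (by linarith) (by linarith)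
      have h2 : 0 ≤ (c 2 - z) / (c 2 - a) := div_nonneg (by linarith) (by linarith)
      simp only [max_eq_left h1, max_eq_right h2, PiLp.add_apply, PiLp.smul_apply,
        PiLp.sub_apply, smul_eq_mul, hqa, hqb]
      field_simp; ring
    · have h1 : 0 ≤ (z - c 2) / (b - c 2) := div_nonneg (by linarith) (by linarith)
      have h2 : (c 2 - z) / (c 2 - a) ≤ 0 :=
        div_nonpos_of_nonpos_of_nonneg (by linarith) (by linarith)
      simp only [max_eq_right h1, max_eq_left h2, PiLp.add_apply, PiLp.smul_apply,
        PiLp.sub_apply, smul_eq_mul, hqa, hqb]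
      field_simp; ring
  · intro z hz
    have main : ∀ (x : Space3), x ∈ M → ∀ s : ℝ, 0 ≤ s → s < 1 →
        c + s • (x - c) ∈ interior M := fun x hx s h0 h1 => by
      have := hconv.combo_interior_self_mem_interior hc hx (a := 1 - s) (b := s)
        (by linarith) h0 (by ring)
      convert this using 1
      rw [smul_sub, sub_smul, one_smul]; abel
    rcases le_total z (c 2) with h | h
    · have h1 : (z - c 2) / (b - c 2) ≤ 0 :=
        div_nonpos_of_nonpos_of_nonneg (by linarith) (by linarith)
      have h2 : 0 ≤ (c 2 - z) / (c 2 - a) := div_nonneg (by linarith) (by linarith)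
      simp only [max_eq_left h1, max_eq_right h2, zero_smul, add_zero]
      exact main q hq _ h2 ((div_lt_one (by linarith)).mpr (by linarith [hz.1]))
    · have h1 : 0 ≤ (z - c 2) / (b - c 2) := div_nonneg (by linarith) (by linarith)
      have h2 : (c 2 - z) / (c 2 - a) ≤ 0 :=
        div_nonpos_of_nonpos_of_nonneg (by linarith) (by linarith)
      simp only [max_eq_right h1, max_eq_left h2, zero_smul, add_zero]
      exact main q' hq' _ h1 ((div_lt_one (by linarith)).mpr (by linarith [hz.2]))

/-- The part of the boundary which is connected to `A` off the compact set `K`, as the trace of an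
open set. -/
theorem exists_isOpen_of_separatesIn {M K A B : Set Space3} (hM : IsCompact M)
    (hconv : Convex ℝ M) (hint : (interior M).Nonempty) (hK : IsClosed K)
    (hA : A ⊆ frontier M) (hAK : Disjoint A K) (hsep : SeparatesIn (frontier M) K A B) :
    ∃ U : Set Space3, IsOpen U ∧ A ⊆ U ∧ (∀ p ∈ frontier M, p ∈ U → p ∉ B) ∧
      ∀ p ∈ frontier M, p ∈ closure U → p ∈ U ∨ p ∈ K := by
  obtain ⟨c, hc⟩ := hint
  obtain ⟨P, hPc, hP, hPid⟩ := exists_radial_projection hM hconv hc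
  -- Components are taken among the directions from `c`, in an open subset of `ℝ³`, where they are
  -- open by local connectedness; `P` carries them to connected subsets of the boundary off `K`.
  set W : Set Space3 := {0}ᶜ ∩ P ⁻¹' Kᶜ with hW
  have hWo : IsOpen W := hPc.isOpen_inter_preimage isOpen_compl_singleton hK.isOpen_compl
  have hne : ∀ p ∈ frontier M, p - c ≠ 0 := fun p hp h =>
    hp.2 (by rwa [sub_eq_zero.mp h])
  have hmemW : ∀ p ∈ frontier M, p ∉ K → p - c ∈ W := fun p hp hpK =>
    ⟨hne p hp, by simpa [hPid p hp] using hpK⟩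
  set V : Set Space3 := {w | w ∈ W ∧ ∃ y ∈ connectedComponentIn W w, P y ∈ A} with hV
  have hVo : IsOpen V := by
    refine isOpen_iff_mem_nhds.mpr fun w hw => ?_
    refine Filter.mem_of_superset
      (hWo.connectedComponentIn.mem_nhds (mem_connectedComponentIn hw.1)) fun x hx => ?_
    refine ⟨connectedComponentIn_subset _ _ hx, ?_⟩
    rw [← connectedComponentIn_eq hx]; exact hw.2
  have hsub : Continuous fun p : Space3 => p - c := by fun_prop
  refine ⟨(fun p => p - c) ⁻¹' V, hVo.preimage hsub, ?_, ?_, ?_⟩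
  · intro p hp
    have h := hmemW p (hA hp) (fun h => hAK.le_bot ⟨hp, h⟩)
    exact ⟨h, _, mem_connectedComponentIn h, by rwa [hPid p (hA hp)]⟩
  · rintro p hp ⟨hpW, y, hy, hyA⟩ hpB
    refine hsep (P '' connectedComponentIn W (p - c)) ?_ ?_ ⟨⟨P y, mem_image_of_mem _ hy, hyA⟩,
      ⟨P (p - c), mem_image_of_mem _ (mem_connectedComponentIn hpW), by rwa [hPid p hp]⟩⟩
    · rintro _ ⟨x, hx, rfl⟩
      have := connectedComponentIn_subset _ _ hx
      exact ⟨(hP x this.1).1, this.2⟩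
    · exact isPreconnected_connectedComponentIn.image _
        (hPc.mono ((connectedComponentIn_subset _ _).trans inter_subset_left))
  · intro p hp hpU
    by_cases hpK : p ∈ K
    · exact Or.inr hpK
    left
    have h := hmemW p hp hpK
    have hnhds : (fun p => p - c) ⁻¹' connectedComponentIn W (p - c) ∈ nhds p :=
      hsub.continuousAt (hWo.connectedComponentIn.mem_nhds (mem_connectedComponentIn h))
    obtain ⟨q, hq, hqV⟩ := mem_closure_iff_nhds.mp hpU _ hnhds
    exact ⟨h, by rw [connectedComponentIn_eq hq]; exact hqV.2⟩

/-- A compact set separating bottom and top of a convex body carries no logarithm of the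
horizontal displacement from an axis. -/
theorem not_exists_log_of_separatesIn {M K : Set Space3} (hM : IsCompact M) (hconv : Convex ℝ M)
    {a b : ℝ} (hab : a < b) (hlow : ∀ p ∈ M, a ≤ p 2)
    {α : ℝ → Space3} (hα : Continuous α) (hα2 : ∀ z, α z 2 = z)
    (hαM : ∀ z ∈ Ioo a b, α z ∈ interior M)
    (hK : IsCompact K) (hKM : K ⊆ frontier M ∩ openSlab a b)
    (hsep : SeparatesIn (frontier M) K (frontier M ∩ {p | p 2 = a}) (frontier M ∩ {p | p 2 = b}))
    (hhigh : ∀ p ∈ M, p 2 ≤ b)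
    {l : Space3 → ℂ} (hl : ContinuousOn l K)
    (hexp : ∀ p ∈ K, Complex.exp (l p) = horiz (p - α (p 2))) : False := by
  have hfrM : frontier M ⊆ M := hM.isClosed.frontier_subset
  have hmid : (a + b) / 2 ∈ Ioo a b := ⟨by linarith, by linarith⟩
  obtain ⟨U, hUo, hAU, hUB, hUcl⟩ := exists_isOpen_of_separatesIn hM hconv ⟨_, hαM _ hmid⟩
    hK.isClosed inter_subset_left
    (disjoint_left.mpr fun p hp hpK => (hKM hpK).2.1.ne' hp.2) hsep
  have hcoord : Continuous fun p : Space3 => p 2 := by fun_prop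
  obtain ⟨v, hv, hvU⟩ : ∃ v ∈ Ioo a b, ∀ p ∈ frontier M, p 2 = v → p ∉ U := by
    -- The closure of `U` within the boundary lies in `U ∪ K` and so stays below height `b`; any `v`
    -- between its maximal height and `b` works. Inserting `a` ensures nonemptiness and `a ≤ m`.
    have hcpt : IsCompact (insert a ((fun p : Space3 => p 2) '' (closure U ∩ frontier M))) :=
      ((((hM.of_isClosed_subset isClosed_frontier hfrM).inter_left isClosed_closure).image
        hcoord).insert a)
    obtain ⟨m, hm, hmax⟩ := hcpt.exists_isGreatest (insert_nonempty _ _)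
    have ham : a ≤ m := hmax (mem_insert _ _)
    have hmb : m < b := by
      rcases hm with rfl | ⟨p, ⟨hpU, hp⟩, rfl⟩
      · exact hab
      · rcases hUcl p hp hpU with h | h
        · exact lt_of_le_of_ne (hhigh p (hfrM hp)) fun h' => hUB p hp h ⟨hp, h'⟩
        · exact (hKM h).2.2
    refine ⟨(m + b) / 2, ⟨by linarith, by linarith⟩, fun p hp hp2 hpU => ?_⟩
    have : p 2 ≤ m := hmax (mem_insert_of_mem _ ⟨p, ⟨subset_closure hpU, hp⟩, rfl⟩)
    linarith
  obtain ⟨P, hPc, hP, -⟩ := exists_radial_projection hM hconv (hαM v hv)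
  -- Directions from `α v`: horizontal for `‖z‖ ≥ 1`, downward inside the unit disc. Thus `Φ` maps
  -- the plane to the boundary at heights at most `v`, and the unit circle to height exactly `v`.
  set w : ℂ → Space3 := fun z => !₂[z.re, z.im, -max 0 (1 - ‖z‖)] with hw
  have hwc : Continuous w := by
    refine (PiLp.continuous_toLp 2 _).comp (continuous_pi fun i => ?_)
    fin_cases i
    · exact Complex.continuous_re
    · exact Complex.continuous_im
    · exact (continuous_const.max (continuous_const.sub continuous_norm)).neg
  have hw0 : ∀ z, w z ≠ 0 := fun z h => by
    have h0 : z.re = 0 := by simpa [hw] using congrArg (fun p : Space3 => p 0) h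
    have h1 : z.im = 0 := by simpa [hw] using congrArg (fun p : Space3 => p 1) h
    have hz : z = 0 := Complex.ext h0 h1
    have h2 := congrArg (fun p : Space3 => p 2) h
    simp [hw, hz] at h2
  set Φ : ℂ → Space3 := fun z => P (w z) with hΦ
  have hΦc : Continuous Φ := hPc.comp_continuous hwc hw0
  have hΦfr : ∀ z, Φ z ∈ frontier M := fun z => (hP _ (hw0 z)).1
  have hΦ2 : ∀ z, Φ z 2 ≤ v := fun z => by
    obtain ⟨-, r, hr, h⟩ := hP _ (hw0 z)
    have h2 : Φ z 2 = v - r * max 0 (1 - ‖z‖) := by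
      simp only [hΦ, h]
      simp [hw, hα2, sub_eq_add_neg]
    have := mul_nonneg hr.le (le_max_left 0 (1 - ‖z‖))
    linarith
  -- By Tietze the logarithm extends to all of space, and the exponential of the extension never
  -- vanishes.
  obtain ⟨G, hG⟩ := ContinuousMap.exists_restrict_eq (X := Space3) (Y := ℂ) hK.isClosed
    ⟨K.domRestrict l, hl.domRestrict⟩
  have hGl : ∀ p ∈ K, G p = l p := fun p hp => congrArg (fun f : C(K, ℂ) => f ⟨p, hp⟩) hG
  set h : Space3 → ℂ := fun p => horiz (p - α (p 2)) with hh
  have hhc : Continuous h := continuous_horiz.comp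
    (continuous_id.sub (hα.comp hcoord))
  classical
  -- On the `U` side, which contains the bottom, the displacement is replaced by `exp G`. The two
  -- agree on the interface, which `Φ` maps into `K`. Off `U` the displacement vanishes only on the
  -- axis, which is interior at these heights.
  refine not_pos_smul_id_on_circle
    ((Φ ⁻¹' U).piecewise (fun z => Complex.exp (G (Φ z))) fun z => h (Φ z)) ?_ ?_ ?_
  · refine continuous_piecewise (fun z hz => ?_) ?_ ?_
    · have hz' := hUcl _ (hΦfr z)
        (closure_mono (image_preimage_subset Φ U)
          (image_closure_subset_closure_image hΦc ⟨z, frontier_subset_closure hz, rfl⟩))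
      have hzU : Φ z ∉ U := fun hzU => by
        rw [(hUo.preimage hΦc).frontier_eq] at hz; exact hz.2 hzU
      have hzK := hz'.resolve_left hzU
      rw [hGl _ hzK, hexp _ hzK]
    · exact (Complex.continuous_exp.comp (G.continuous.comp hΦc)).continuousOn
    · exact (hhc.comp hΦc).continuousOn
  · intro z
    by_cases hz : z ∈ Φ ⁻¹' U
    · rw [piecewise_eq_of_mem _ _ _ hz]; exact Complex.exp_ne_zero _
    · rw [piecewise_eq_of_notMem _ _ _ hz]
      intro h0
      have ha : a < Φ z 2 := lt_of_le_of_ne (hlow _ (hfrM (hΦfr z)))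
        fun h' => hz (hAU ⟨hΦfr z, h'.symm⟩)
      have heq := eq_of_horiz_sub_eq_zero h0 (hα2 _).symm
      have hin := hαM _ ⟨ha, (hΦ2 z).trans_lt hv.2⟩
      rw [← heq] at hin
      exact (hΦfr z).2 hin
  · intro z hz
    obtain ⟨-, r, hr, hPr⟩ := hP _ (hw0 z)
    have hΦv : Φ z 2 = v := by
      simp only [hΦ, hPr]
      simp [hw, hα2, hz]
    refine ⟨r, hr, ?_⟩
    rw [piecewise_eq_of_notMem (Φ ⁻¹' U) _ _ (hvU _ (hΦfr z) hΦv)]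
    simp only [hh, hΦv]
    simp only [hΦ, hPr]
    apply Complex.ext <;> simp [horiz, hw]

/-! ### Smooth local normals of a convex body -/

/-- `n` is a smooth field of unit vectors on `U` which extends the outward unit normal of the
convex body `M` along the part of its boundary in `U`, where `M` is locally a smooth domain. -/
structure IsLocalNormal (M U : Set Space3) (n : Space3 → Space3) : Prop where
  isOpen : IsOpen U
  contDiffOn : ContDiffOn ℝ ∞ n U
  norm_eq : ∀ p ∈ U, ‖n p‖ = 1
  outerNormal_eq : ∀ p ∈ frontier M ∩ U, outerNormal M p = n p
  supports : ∀ p ∈ frontier M ∩ U, ∀ q ∈ M, ⟪n p, q - p⟫ ≤ 0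
  inward : ∀ p ∈ frontier M ∩ U, ∀ w, ⟪n p, w⟫ < 0 → ∀ᶠ s in nhdsWithin (0 : ℝ) (Ioi 0),
    p + s • w ∈ M
  symm : ∀ p ∈ frontier M ∩ U, ∀ v w, ⟪n p, v⟫ = 0 → ⟪n p, w⟫ = 0 →
    ⟪fderiv ℝ n p v, w⟫ = ⟪fderiv ℝ n p w, v⟫

/-- The gradient of a function on `ℝ³`. -/
noncomputable def coordGradient (f : Space3 → ℝ) (p : Space3) : Space3 :=
  ∑ i, fderiv ℝ f p (EuclideanSpace.single i 1) • (EuclideanSpace.single i (1 : ℝ) : Space3)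

theorem inner_coordGradient (f : Space3 → ℝ) (p v : Space3) :
    ⟪coordGradient f p, v⟫ = fderiv ℝ f p v := by
  have hv : v = ∑ i, v i • (EuclideanSpace.single i (1 : ℝ) : Space3) := by
    ext j; fin_cases j <;> simp [Fin.sum_univ_three]
  conv_rhs => rw [hv]
  simp [coordGradient, sum_inner, inner_smul_left, EuclideanSpace.inner_single_left, mul_comm]

theorem coordGradient_ne_zero {f : Space3 → ℝ} {p : Space3} (h : fderiv ℝ f p ≠ 0) :
    coordGradient f p ≠ 0 := fun h0 => h <| by
  ext v; rw [← inner_coordGradient, h0]; simp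

theorem contDiffOn_coordGradient {f : Space3 → ℝ} {U : Set Space3} (hU : IsOpen U)
    (hf : ContDiffOn ℝ ∞ f U) : ContDiffOn ℝ ∞ (coordGradient f) U := by
  have h := hf.fderiv_of_isOpen (m := ∞) hU (by simp)
  unfold coordGradient
  exact ContDiffOn.sum fun i _ => (h.clm_apply contDiffOn_const).smul contDiffOn_const

/-- A convex body with smooth boundary at `p` has a smooth local normal field near `p`. -/
theorem exists_isLocalNormal {M : Set Space3} (hM : IsClosed M) (hconv : Convex ℝ M)
    {p₀ : Space3} (hp₀ : SmoothBoundaryAt M p₀) :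
    ∃ U n, p₀ ∈ U ∧ IsLocalNormal M U n := by
  obtain ⟨U₀, f, hU₀, hpU₀, hf, hfp, hdf, hMU⟩ := hp₀
  set G := coordGradient f with hG
  have hGs : ContDiffOn ℝ ∞ G U₀ := contDiffOn_coordGradient hU₀ hf
  set U : Set Space3 := U₀ ∩ G ⁻¹' {0}ᶜ with hU
  have hUo : IsOpen U := hGs.continuousOn.isOpen_inter_preimage hU₀ isOpen_compl_singleton
  have hUU : U ⊆ U₀ := inter_subset_left
  have hG0 : ∀ p ∈ U, G p ≠ 0 := fun p hp => hp.2
  have hns : ContDiffOn ℝ ∞ (fun p => ‖G p‖⁻¹ • G p) U :=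
    (((hGs.mono hUU).norm ℝ hG0).inv fun p hp => norm_ne_zero_iff.mpr (hG0 p hp)).smul
      (hGs.mono hUU)
  have hpos : ∀ p ∈ U, 0 < ‖G p‖ := fun p hp => norm_pos_iff.mpr (hG0 p hp)
  have hn1 : ∀ p ∈ U, ‖‖G p‖⁻¹ • G p‖ = 1 := fun p hp => by
    rw [norm_smul, norm_inv, norm_norm, inv_mul_cancel₀ (hpos p hp).ne']
  have hin : ∀ p w, ⟪‖G p‖⁻¹ • G p, w⟫ = ‖G p‖⁻¹ * fderiv ℝ f p w := fun p w => by
    rw [real_inner_smul_left, inner_coordGradient]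
  have hcrit : ∀ x ∈ U₀, x ∈ M ↔ f x ≤ 0 := fun x hx => by
    have : x ∈ M ∩ U₀ ↔ x ∈ {x ∈ U₀ | f x ≤ 0} := by rw [hMU]
    simpa [hx] using this
  have hf0 : ∀ p ∈ frontier M ∩ U, f p = 0 := by
    rintro p ⟨hp, hpU⟩
    refine le_antisymm ((hcrit p (hUU hpU)).mp (hM.frontier_subset hp)) ?_
    by_contra! hlt
    refine hp.2 (mem_interior_iff_mem_nhds.mpr ?_)
    have hc := (hf.continuousOn.continuousAt (hU₀.mem_nhds (hUU hpU))).eventually_lt_const hlt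
    filter_upwards [hc, hU₀.mem_nhds (hUU hpU)] with x hx hxU
    exact (hcrit x hxU).mpr hx.le
  have hder : ∀ p ∈ U, HasFDerivAt f (fderiv ℝ f p) p := fun p hp =>
    ((hf.differentiableOn (by simp)).differentiableAt (hU₀.mem_nhds (hUU hp))).hasFDerivAt
  have hline : ∀ p ∈ U, ∀ w, HasDerivAt (fun s : ℝ => f (p + s • w)) (fderiv ℝ f p w) 0 := by
    intro p hp w
    have h2 : HasDerivAt (fun s : ℝ => p + s • w) w 0 := by
      simpa using ((hasDerivAt_id (0 : ℝ)).smul_const w).const_add p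
    have h1 : HasFDerivAt f (fderiv ℝ f p) (p + (0 : ℝ) • w) := by simpa using hder p hp
    exact h1.comp_hasDerivAt 0 h2
  have hnear : ∀ p ∈ U, ∀ w, ∀ᶠ s in nhds (0 : ℝ), p + s • w ∈ U₀ := fun p hp w => by
    have hc : Continuous fun s : ℝ => p + s • w := by fun_prop
    exact hc.continuousAt (hU₀.mem_nhds (by simpa using hUU hp))
  have hinward : ∀ p ∈ frontier M ∩ U, ∀ w, ⟪‖G p‖⁻¹ • G p, w⟫ < 0 →
      ∀ᶠ s in nhdsWithin (0 : ℝ) (Ioi 0), p + s • w ∈ M := by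
    intro p hp w hw
    rw [hin] at hw
    have hw' : fderiv ℝ f p w < 0 :=
      neg_of_mul_neg_right hw (inv_nonneg.mpr (norm_nonneg _))
    have hs := (hasDerivAt_iff_tendsto_slope.mp (hline p hp.2 w)).eventually_lt_const hw'
    have hs' := nhdsWithin_mono (0 : ℝ) (fun x (hx : x ∈ Ioi 0) => ne_of_gt hx) hs
    filter_upwards [hs', nhdsWithin_le_nhds (hnear p hp.2 w), self_mem_nhdsWithin]
      with s h1 h2 h3
    refine (hcrit _ h2).mpr ?_
    have h1' : slope (fun s : ℝ => f (p + s • w)) 0 s < 0 := h1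
    rw [slope_def_field] at h1'
    simp only [zero_smul, add_zero, sub_zero, hf0 p hp] at h1'
    by_contra! hcon
    exact absurd h1' (not_lt.mpr (div_nonneg hcon.le (le_of_lt h3)))
  have hsupp : ∀ p ∈ frontier M ∩ U, ∀ q ∈ M, ⟪‖G p‖⁻¹ • G p, q - p⟫ ≤ 0 := by
    intro p hp q hq
    rw [hin]
    refine mul_nonpos_of_nonneg_of_nonpos (inv_nonneg.mpr (norm_nonneg _)) ?_
    by_contra! hcon
    have hs := (hasDerivAt_iff_tendsto_slope.mp (hline p hp.2 (q - p))).eventually_const_lt hcon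
    have hs' := nhdsWithin_mono (0 : ℝ) (fun x (hx : x ∈ Ioi 0) => ne_of_gt hx) hs
    have hev : ∀ᶠ s in nhdsWithin (0 : ℝ) (Ioi 0), False := by
      filter_upwards [hs', nhdsWithin_le_nhds (hnear p hp.2 (q - p)), self_mem_nhdsWithin,
        nhdsWithin_le_nhds (Iio_mem_nhds (zero_lt_one' ℝ))] with s h1 h2 h3 h4
      have h1' : 0 < slope (fun s : ℝ => f (p + s • (q - p))) 0 s := h1
      rw [slope_def_field] at h1'
      simp only [zero_smul, add_zero, sub_zero, hf0 p hp] at h1'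
      have h3' : (0 : ℝ) < s := h3
      have hmem : p + s • (q - p) ∈ M :=
        hconv.add_smul_sub_mem (hM.frontier_subset hp.1) hq ⟨h3'.le, le_of_lt h4⟩
      exact absurd h1' (not_lt.mpr (div_nonpos_of_nonpos_of_nonneg ((hcrit _ h2).mp hmem) h3'.le))
    exact hev.exists.elim fun _ h => h
  refine ⟨U, fun p => ‖G p‖⁻¹ • G p, ⟨hpU₀, coordGradient_ne_zero hdf⟩, hUo, hns, hn1, ?_, hsupp,
    hinward, ?_⟩
  · intro p hp
    obtain ⟨hX1, hX⟩ := Classical.epsilon_spec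
      (p := fun X : Space3 => ‖X‖ = 1 ∧ ∀ q ∈ M, ⟪X, q - p⟫ ≤ 0)
      ⟨_, hn1 p hp.2, hsupp p hp⟩
    change ‖outerNormal M p‖ = 1 at hX1
    change ∀ q ∈ M, ⟪outerNormal M p, q - p⟫ ≤ 0 at hX
    set X := outerNormal M p
    set N := ‖G p‖⁻¹ • G p
    have hN1 : ‖N‖ = 1 := hn1 p hp.2
    -- If `X ≠ N`, then `X - N` points into `M` by `hinward`, while `⟪X, X - N⟫ > 0` contradicts
    -- that `X` supports `M`.
    by_contra hne
    have hlt : ⟪N, X⟫ < 1 := by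
      refine lt_of_le_of_ne ?_ fun h => hne ?_
      · simpa [hN1, hX1] using real_inner_le_norm N X
      · exact ((inner_eq_one_iff_of_norm_eq_one hN1 hX1).mp h).symm
    have hw : ⟪N, X - N⟫ < 0 := by
      rw [inner_sub_right, real_inner_self_eq_norm_sq, hN1]; linarith
    obtain ⟨s, hs, hs0⟩ := ((hinward p hp _ hw).and self_mem_nhdsWithin).exists
    have h := hX _ hs
    rw [add_sub_cancel_left, real_inner_smul_right, inner_sub_right, real_inner_self_eq_norm_sq,
      hX1, real_inner_comm] at h
    have hs0' : (0 : ℝ) < s := hs0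
    nlinarith
  · intro p hp v w hv hw
    have hpU := hp.2
    set n : Space3 → Space3 := fun p => ‖G p‖⁻¹ • G p with hn
    have hnd : HasFDerivAt n (fderiv ℝ n p) p :=
      ((hns.differentiableOn (by simp)).differentiableAt (hUo.mem_nhds hpU)).hasFDerivAt
    have hNd : HasFDerivAt (fun q => ‖G q‖) (fderiv ℝ (fun q => ‖G q‖) p) p :=
      ((((hGs.mono hUU).norm ℝ hG0).differentiableOn (by simp)).differentiableAt
        (hUo.mem_nhds hpU)).hasFDerivAt
    have hdf' : ContDiffAt ℝ ∞ f p := hf.contDiffAt (hU₀.mem_nhds (hUU hpU))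
    have hsymm : IsSymmSndFDerivAt ℝ f p := hdf'.isSymmSndFDerivAt (by
      rw [minSmoothness_of_isRCLikeNormedField]; exact ENat.LEInfty.out)
    have hddf : HasFDerivAt (fderiv ℝ f) (fderiv ℝ (fderiv ℝ f) p) p :=
      ((hdf'.fderiv_right (m := ∞) (by simp)).differentiableAt (by simp)).hasFDerivAt
    -- On tangent vectors the shape operator is the Hessian of `f` divided by `‖G‖`: the derivative
    -- of the factor `‖G‖` is multiplied by `⟪n, w⟫ = 0`. Symmetry of the Hessian then gives the
    -- claim.
    have key : ∀ v w, ⟪n p, w⟫ = 0 →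
        fderiv ℝ (fderiv ℝ f) p v w = ‖G p‖ * ⟪fderiv ℝ n p v, w⟫ := by
      intro v w hw
      have h1 : HasFDerivAt (fun q => fderiv ℝ f q w)
          ((ContinuousLinearMap.apply ℝ ℝ w).comp (fderiv ℝ (fderiv ℝ f) p)) p :=
        (ContinuousLinearMap.apply ℝ ℝ w).hasFDerivAt.comp p hddf
      have h2 := hNd.mul (hnd.inner ℝ (hasFDerivAt_const w p))
      have heq : (fun q => fderiv ℝ f q w) =ᶠ[nhds p] fun q => ‖G q‖ * ⟪n q, w⟫ := by
        filter_upwards [hUo.mem_nhds hpU] with q hq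
        rw [hn, hin, mul_inv_cancel_left₀ (hpos q hq).ne']
      have h3 := congrArg (fun T => T v) (h1.unique (h2.congr_of_eventuallyEq heq))
      simpa [hw] using h3
    have h := hsymm v w
    rw [key v w hw, key w v hv] at h
    exact mul_left_cancel₀ (hpos p hpU).ne' h

namespace IsLocalNormal

variable {M U : Set Space3} {n : Space3 → Space3}

theorem mem_bdryTangent_iff (h : IsLocalNormal M U n) {p : Space3} (hp : p ∈ frontier M ∩ U)
    {v : Space3} : v ∈ bdryTangent M p ↔ ⟪n p, v⟫ = 0 := by
  rw [bdryTangent, Submodule.mem_orthogonal_singleton_iff_inner_right, h.outerNormal_eq p hp]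

theorem hasFDerivAt (h : IsLocalNormal M U n) {p : Space3} (hp : p ∈ U) :
    HasFDerivAt n (fderiv ℝ n p) p :=
  ((h.contDiffOn.differentiableOn (by simp)).differentiableAt (h.isOpen.mem_nhds hp)).hasFDerivAt

/-- Tangent vectors of the boundary are limits of difference quotients of boundary points. -/
theorem exists_seq_tangent (h : IsLocalNormal M U n) (hM : IsClosed M) {p : Space3}
    (hp : p ∈ frontier M ∩ U) {v : Space3} (hv : ⟪n p, v⟫ = 0) :
    ∃ (c : ℕ → ℝ) (d : ℕ → Space3), Filter.Tendsto d Filter.atTop (nhds 0) ∧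
      (∀ k, p + d k ∈ frontier M) ∧
      Filter.Tendsto (fun k => c k • d k) Filter.atTop (nhds v) := by
  have hnn : ⟪n p, n p⟫ = 1 := by rw [real_inner_self_eq_norm_sq, h.norm_eq p hp.2, one_pow]
  -- Tilting `v` slightly inward gives points of `M`. Either `p + s • v` is itself in `M`, hence on
  -- the boundary since it lies on the supporting plane, or the segment from it to the tilted point
  -- crosses the boundary.
  have main : ∀ k : ℕ, ∃ s μ : ℝ, 0 < s ∧ s < 1 / ((k : ℝ) + 1) ∧ 0 ≤ μ ∧
      μ ≤ 1 / ((k : ℝ) + 1) ∧ p + s • (v - μ • n p) ∈ frontier M := by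
    intro k
    set ε : ℝ := 1 / ((k : ℝ) + 1)
    have hε : 0 < ε := by positivity
    have hw : ⟪n p, v - ε • n p⟫ < 0 := by
      rw [inner_sub_right, real_inner_smul_right, hv, hnn]; linarith
    obtain ⟨s, ⟨hs, hs0⟩, hsε⟩ := (((h.inward p hp _ hw).and self_mem_nhdsWithin).and
      (nhdsWithin_le_nhds (Iio_mem_nhds hε))).exists
    have hs0' : (0 : ℝ) < s := hs0
    by_cases hin : p + s • v ∈ M
    · refine ⟨s, 0, hs0', hsε, le_rfl, hε.le, ?_⟩
      rw [zero_smul, sub_zero]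
      refine ⟨subset_closure hin, fun hint => ?_⟩
      have hc : Continuous fun t : ℝ => p + s • v + t • n p := by fun_prop
      have hev : ∀ᶠ t in nhds (0 : ℝ), p + s • v + t • n p ∈ M :=
        hc.continuousAt (by simpa using mem_interior_iff_mem_nhds.mp hint)
      obtain ⟨t, ht, ht0⟩ := ((Filter.Eventually.filter_mono nhdsWithin_le_nhds hev).and
        (self_mem_nhdsWithin (s := Ioi (0 : ℝ)))).exists
      have := h.supports p hp _ ht
      rw [add_assoc, add_sub_cancel_left, inner_add_right, real_inner_smul_right,
        real_inner_smul_right, hv, hnn] at this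
      have ht0' : (0 : ℝ) < t := ht0
      linarith
    · have hc : Continuous fun μ : ℝ => p + s • (v - μ • n p) := by fun_prop
      have hpre : IsPreconnected ((fun μ : ℝ => p + s • (v - μ • n p)) '' Icc 0 ε) :=
        isPreconnected_Icc.image _ hc.continuousOn
      obtain ⟨μ, hμ, hfr⟩ : ∃ μ ∈ Icc 0 ε, p + s • (v - μ • n p) ∈ frontier M := by
        by_contra! hcon
        obtain ⟨x, -, hx1, hx2⟩ := hpre (interior M) Mᶜ isOpen_interior hM.isOpen_compl
          (by
            rintro _ ⟨μ, hμ, rfl⟩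
            by_cases hmem : p + s • (v - μ • n p) ∈ M
            · exact Or.inl (by_contra fun hni => hcon μ hμ ⟨subset_closure hmem, hni⟩)
            · exact Or.inr hmem)
          ⟨_, ⟨ε, right_mem_Icc.mpr hε.le, rfl⟩, by_contra fun hni =>
            hcon ε (right_mem_Icc.mpr hε.le) ⟨subset_closure hs, hni⟩⟩
          ⟨_, ⟨0, left_mem_Icc.mpr hε.le, rfl⟩, by simpa using hin⟩
        exact hx2 (interior_subset hx1)
      exact ⟨s, μ, hs0', hsε, hμ.1, hμ.2, hfr⟩
  choose s μ hs0 hs hμ0 hμ hfr using main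
  have hst : Filter.Tendsto s Filter.atTop (nhds 0) :=
    squeeze_zero (fun k => (hs0 k).le) (fun k => (hs k).le) tendsto_one_div_add_atTop_nhds_zero_nat
  have hμt : Filter.Tendsto μ Filter.atTop (nhds 0) :=
    squeeze_zero hμ0 hμ tendsto_one_div_add_atTop_nhds_zero_nat
  have hvt : Filter.Tendsto (fun k => v - μ k • n p) Filter.atTop (nhds v) := by
    simpa using tendsto_const_nhds.sub (hμt.smul_const (n p))
  refine ⟨fun k => (s k)⁻¹, fun k => s k • (v - μ k • n p), ?_, hfr, ?_⟩
  · simpa using hst.smul hvt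
  · refine hvt.congr fun k => ?_
    rw [smul_smul, inv_mul_cancel₀ (hs0 k).ne', one_smul]

/-- A derivative within the boundary is determined only on the tangent cone; this membership makes
`bdryDeriv` on tangent vectors computable from any local extension. -/
theorem mem_tangentConeAt (h : IsLocalNormal M U n) (hM : IsClosed M) {p : Space3}
    (hp : p ∈ frontier M ∩ U) {v : Space3} (hv : ⟪n p, v⟫ = 0) :
    v ∈ tangentConeAt ℝ (frontier M) p := by
  obtain ⟨c, d, hd, hfr, hcd⟩ := h.exists_seq_tangent hM hp hv
  exact mem_tangentConeAt_of_seq Filter.atTop c d hd (Filter.Eventually.of_forall hfr) hcd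

/-- The shape operator of a convex surface is positive semidefinite. -/
theorem inner_fderiv_nonneg (h : IsLocalNormal M U n) (hM : IsClosed M) {p : Space3}
    (hp : p ∈ frontier M ∩ U) {v : Space3} (hv : ⟪n p, v⟫ = 0) :
    0 ≤ ⟪fderiv ℝ n p v, v⟫ := by
  obtain ⟨c, d, hd, hfr, hcd⟩ := h.exists_seq_tangent hM hp hv
  have hlim := (h.hasFDerivAt hp.2).hasFDerivWithinAt.lim (s := univ) hd
    (Filter.Eventually.of_forall fun _ => mem_univ _) hcd
  refine ge_of_tendsto (hlim.inner hcd) ?_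
  have hpd : Filter.Tendsto (fun k => p + d k) Filter.atTop (nhds p) := by
    simpa using tendsto_const_nhds.add hd
  filter_upwards [hpd (h.isOpen.mem_nhds hp.2)] with k hk
  -- The support inequalities at `p` and at `p + d k` together give monotonicity of the normal, `⟪n
  -- (p + d k) - n p, d k⟫ ≥ 0`, which passes to the limit after scaling by `(c k)²`.
  have h1 := h.supports p hp _ (hM.frontier_subset (hfr k))
  have h2 := h.supports _ ⟨hfr k, hk⟩ p (hM.frontier_subset hp.1)
  rw [add_sub_cancel_left] at h1
  rw [sub_add_cancel_left, inner_neg_right] at h2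
  rw [real_inner_smul_left, real_inner_smul_right, inner_sub_left, ← mul_assoc]
  exact mul_nonneg (mul_self_nonneg _) (by linarith)

/-- The derivative along the boundary of a field which extends to `M` near `p`. -/
theorem bdryDeriv_eq (h : IsLocalNormal M U n) (hM : IsClosed M) {F : Type*}
    [NormedAddCommGroup F] [NormedSpace ℝ F] {φ ψ : Space3 → F} {L : Space3 →L[ℝ] F}
    {p : Space3} (hp : p ∈ frontier M ∩ U) (hψ : HasFDerivWithinAt ψ L (M ∩ U) p)
    (heq : ∀ q ∈ frontier M ∩ U, φ q = ψ q) {v : Space3} (hv : ⟪n p, v⟫ = 0) :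
    bdryDeriv M φ p v = L v := by
  have h1 : HasFDerivWithinAt ψ L (frontier M ∩ U) p :=
    hψ.mono (inter_subset_inter_left _ hM.frontier_subset)
  have h2 : HasFDerivWithinAt φ L (frontier M) p :=
    (h1.congr heq (heq p hp)).mono_of_mem_nhdsWithin
      (inter_mem_nhdsWithin _ (h.isOpen.mem_nhds hp.2))
  exact h2.differentiableWithinAt.hasFDerivWithinAt.unique_on h2 (h.mem_tangentConeAt hM hp hv)

theorem mono (h : IsLocalNormal M U n) {V : Set Space3} (hV : IsOpen V) (hVU : V ⊆ U) :
    IsLocalNormal M V n where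
  isOpen := hV
  contDiffOn := h.contDiffOn.mono hVU
  norm_eq p hp := h.norm_eq p (hVU hp)
  outerNormal_eq p hp := h.outerNormal_eq p ⟨hp.1, hVU hp.2⟩
  supports p hp := h.supports p ⟨hp.1, hVU hp.2⟩
  inward p hp := h.inward p ⟨hp.1, hVU hp.2⟩
  symm p hp := h.symm p ⟨hp.1, hVU hp.2⟩

theorem continuousOn_fderiv (h : IsLocalNormal M U n) : ContinuousOn (fderiv ℝ n) U :=
  h.contDiffOn.continuousOn_fderiv_of_isOpen h.isOpen (by simp)

end IsLocalNormal

/-! ### Linear algebra of the curvature comparison -/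

/-- The trace inequality `tr (S A) ≤ ‖A‖ tr S` for a positive semidefinite `2 × 2` matrix `S`. -/
theorem trace_mul_le_of_posSemidef {s₁ s₂ s₃ a₁ a₂ b₁ b₂ H : ℝ} (hH : 0 ≤ H)
    (hS : ∀ x y : ℝ, 0 ≤ s₁ * x ^ 2 + 2 * s₂ * (x * y) + s₃ * y ^ 2)
    (hA : ∀ x y : ℝ, (s₁ + s₃) ^ 2 * ((x * a₁ + y * b₁) ^ 2 + (x * a₂ + y * b₂) ^ 2) ≤
      H ^ 2 * (x ^ 2 + y ^ 2)) :
    s₁ * a₁ + s₂ * (a₂ + b₁) + s₃ * b₂ ≤ H := by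
  have h1 : 0 ≤ s₁ := by simpa using hS 1 0
  have h3 : 0 ≤ s₃ := by simpa using hS 0 1
  have h2 : s₂ ^ 2 ≤ s₁ * s₃ := by
    have := discrim_le_zero (a := s₁) (b := 2 * s₂) (c := s₃) fun x => by
      have := hS x 1
      linarith
    rw [discrim] at this
    linarith
  -- Cauchy–Schwarz turns the norm bound on `A` into a bound on its quadratic form.
  have hQ : ∀ x y : ℝ, (s₁ + s₃) * (x * (x * a₁ + y * b₁) + y * (x * a₂ + y * b₂)) ≤
      H * (x ^ 2 + y ^ 2) := by
    intro x y
    refine le_of_abs_le (abs_le_of_sq_le_sq ?_ (by positivity))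
    have hc : (x * (x * a₁ + y * b₁) + y * (x * a₂ + y * b₂)) ^ 2 ≤
        (x ^ 2 + y ^ 2) * ((x * a₁ + y * b₁) ^ 2 + (x * a₂ + y * b₂) ^ 2) := by
      nlinarith [sq_nonneg (x * (x * a₂ + y * b₂) - y * (x * a₁ + y * b₁))]
    calc _ = (s₁ + s₃) ^ 2 * (x * (x * a₁ + y * b₁) + y * (x * a₂ + y * b₂)) ^ 2 := by ring
      _ ≤ (s₁ + s₃) ^ 2 *
          ((x ^ 2 + y ^ 2) * ((x * a₁ + y * b₁) ^ 2 + (x * a₂ + y * b₂) ^ 2)) := by gcongr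
      _ = (x ^ 2 + y ^ 2) *
          ((s₁ + s₃) ^ 2 * ((x * a₁ + y * b₁) ^ 2 + (x * a₂ + y * b₂) ^ 2)) := by ring
      _ ≤ (x ^ 2 + y ^ 2) * (H ^ 2 * (x ^ 2 + y ^ 2)) :=
          mul_le_mul_of_nonneg_left (hA x y) (by positivity)
      _ = _ := by ring
  rcases h1.eq_or_lt with h1 | h1
  · have h2' : s₂ = 0 := by
      rw [← h1, zero_mul] at h2
      exact pow_eq_zero_iff two_ne_zero |>.mp (le_antisymm h2 (sq_nonneg _))
    have := hQ 0 1
    rw [← h1] at this ⊢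
    rw [h2']
    linarith
  -- Completing the square, `s₁ S = u uᵀ + (det S) e₂ e₂ᵀ` with `u = (s₁, s₂)`; so `s₁ tr (S A)` is
  -- a nonnegative combination of the values of the form of `A` at `u` and `e₂`.
  · have e1 := hQ s₁ s₂
    have e2 := mul_le_mul_of_nonneg_left (hQ 0 1) (sub_nonneg.mpr h2)
    refine le_of_mul_le_mul_left (a := (s₁ + s₃) * s₁) ?_ (by positivity)
    linear_combination e1 + e2

/-- The left side is the trace of `S A` with `A` sending `a, b` to `ν, T`. As `x • ν + y • T` has
squared `g`-length `x² + y²`, the comparison bounds `(tr S) ‖A‖` by `H`, and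
`trace_mul_le_of_posSemidef` applies. -/
theorem inner_add_inner_le_of_comparison {E : Type*} [NormedAddCommGroup E]
    [InnerProductSpace ℝ E] {X a b ν T : E} {S : E →L[ℝ] E} {G : E →L[ℝ] E →L[ℝ] ℝ} {H : ℝ}
    (hframe : ∀ v, ⟪X, v⟫ = 0 → v = ⟪a, v⟫ • a + ⟪b, v⟫ • b) (ha : ⟪X, a⟫ = 0) (hb : ⟪X, b⟫ = 0)
    (hsymm : ∀ v w, ⟪X, v⟫ = 0 → ⟪X, w⟫ = 0 → ⟪S v, w⟫ = ⟪S w, v⟫)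
    (hpsd : ∀ v, ⟪X, v⟫ = 0 → 0 ≤ ⟪S v, v⟫)
    (hG : ∀ v w, G v w = G w v) (hν : ⟪X, ν⟫ = 0) (hT : ⟪X, T⟫ = 0)
    (hνν : G ν ν = 1) (hTT : G T T = 1) (hνT : G ν T = 0) (hH : 0 ≤ H)
    (hcomp : ∀ v, ⟪X, v⟫ = 0 → (⟪S a, a⟫ + ⟪S b, b⟫) ^ 2 * ⟪v, v⟫ ≤ H ^ 2 * G v v) :
    ⟪S ν, a⟫ + ⟪S T, b⟫ ≤ H := by
  have hba := hsymm b a hb ha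
  have expand : ∀ v, ⟪X, v⟫ = 0 → ⟪v, v⟫ = ⟪a, v⟫ ^ 2 + ⟪b, v⟫ ^ 2 := fun v hv => by
    conv_lhs => rw [hframe v hv]
    rw [inner_add_left, real_inner_smul_left, real_inner_smul_left, ← hframe v hv]
    ring
  have key := trace_mul_le_of_posSemidef (s₁ := ⟪S a, a⟫) (s₂ := ⟪S a, b⟫) (s₃ := ⟪S b, b⟫)
    (a₁ := ⟪a, ν⟫) (a₂ := ⟪b, ν⟫) (b₁ := ⟪a, T⟫) (b₂ := ⟪b, T⟫) hH
    (fun x y => by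
      have := hpsd (x • a + y • b) (by simp [inner_add_right, real_inner_smul_right, ha, hb])
      simp only [map_add, map_smul, inner_add_left, inner_add_right, real_inner_smul_left,
        real_inner_smul_right, hba] at this
      linarith)
    (fun x y => by
      have hv : ⟪X, x • ν + y • T⟫ = 0 := by
        simp [inner_add_right, real_inner_smul_right, hν, hT]
      have := hcomp _ hv
      rw [expand _ hv] at this
      simp only [inner_add_right, real_inner_smul_right, map_add, map_smul,
        add_apply, smul_apply, smul_eq_mul, hνν, hTT,
        hνT, hG T ν] at this
      linarith)
  have e1 : ⟪S ν, a⟫ = ⟪a, ν⟫ * ⟪S a, a⟫ + ⟪b, ν⟫ * ⟪S a, b⟫ := by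
    conv_lhs => rw [hframe ν hν]
    simp only [map_add, map_smul, inner_add_left, real_inner_smul_left, hba]
  have e2 : ⟪S T, b⟫ = ⟪a, T⟫ * ⟪S a, b⟫ + ⟪b, T⟫ * ⟪S b, b⟫ := by
    conv_lhs => rw [hframe T hT]
    simp only [map_add, map_smul, inner_add_left, real_inner_smul_left]
  rw [e1, e2]
  linarith

/-- The frame of the tangent plane of the sphere given by the polar coordinates. -/
theorem exists_polar_frame {X : Space3} (hX : ‖X‖ = 1) {s : ℝ} (hs : 0 < s)
    (hs2 : s ^ 2 = 1 - X 2 ^ 2) :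
    ∃ a b : Space3, ⟪X, a⟫ = 0 ∧ ⟪X, b⟫ = 0 ∧
      (∀ v, ⟪X, v⟫ = 0 → v = ⟪a, v⟫ • a + ⟪b, v⟫ • b) ∧
      (∀ v, ⟪X, v⟫ = 0 → ⟪v, a⟫ = -(v 2 / s)) ∧
      (∀ v, ⟪v, b⟫ = (X 0 * v 1 - X 1 * v 0) / s) ∧
      ∀ i, EuclideanSpace.single i (1 : ℝ) - X i • X = a i • a + b i • b := by
  have hs0 := hs.ne'
  have hsum : X 0 ^ 2 + X 1 ^ 2 + X 2 ^ 2 = 1 := by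
    have h := EuclideanSpace.norm_sq_eq X
    rw [hX] at h
    simp only [Fin.sum_univ_three, Real.norm_eq_abs, sq_abs] at h
    linarith
  have hh : X 0 ^ 2 + X 1 ^ 2 = s ^ 2 := by linarith
  have hin : ∀ v w : Space3, ⟪v, w⟫ = v 0 * w 0 + v 1 * w 1 + v 2 * w 2 := fun v w => by
    simp [PiLp.inner_apply, Fin.sum_univ_three, mul_comm]
  -- With `s` the sine of the polar angle of `X`, `a` and `b` are the unit directions of increasing
  -- polar angle and of increasing azimuth.
  set a : Space3 := !₂[X 0 * X 2 / s, X 1 * X 2 / s, -s] with ha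
  set b : Space3 := !₂[-X 1 / s, X 0 / s, 0] with hb
  have a0 : a 0 = X 0 * X 2 / s := rfl
  have a1 : a 1 = X 1 * X 2 / s := rfl
  have a2 : a 2 = -s := rfl
  have b0 : b 0 = -X 1 / s := rfl
  have b1 : b 1 = X 0 / s := rfl
  have b2 : b 2 = 0 := rfl
  have hproj : ∀ i, EuclideanSpace.single i (1 : ℝ) - X i • X = a i • a + b i • b := by
    intro i
    ext j
    have hs2' : X 2 ^ 2 = 1 - s ^ 2 := by linarith
    fin_cases i <;> fin_cases j <;>
      simp [a0, a1, a2, b0, b1, b2] <;> field_simp <;>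
      first
        | ring1
        | linear_combination -X 0 * X 1 * hs2'
        | linear_combination -X 0 ^ 2 * hs2' - hh
        | linear_combination -X 1 ^ 2 * hs2' - hh
        | linear_combination -hs2'
  refine ⟨a, b, ?_, ?_, ?_, ?_, ?_, hproj⟩
  · rw [hin, a0, a1, a2]; field_simp; linear_combination X 2 * hh
  · rw [hin, b0, b1, b2]; field_simp; ring
  · intro v hv
    have hsingle : v = ∑ i, v i • (EuclideanSpace.single i (1 : ℝ) : Space3) := by
      ext j; fin_cases j <;> simp [Fin.sum_univ_three]
    have h : ∑ i, v i • (EuclideanSpace.single i (1 : ℝ) - X i • X) =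
        ∑ i, v i • (a i • a + b i • b) := by simp only [hproj]
    simp only [smul_sub, Finset.sum_sub_distrib, ← hsingle] at h
    have hz : ∑ i, v i • X i • X = 0 := by
      rw [hin] at hv
      simp only [smul_smul, ← Finset.sum_smul, Fin.sum_univ_three]
      rw [show v 0 * X 0 + v 1 * X 1 + v 2 * X 2 = 0 by linarith, zero_smul]
    rw [hz, sub_zero] at h
    refine h.trans ?_
    simp only [smul_add, smul_smul, Finset.sum_add_distrib, ← Finset.sum_smul]
    simp only [hin, Fin.sum_univ_three]
    congr 2 <;> ring
  · intro v hv
    rw [hin] at hv ⊢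
    rw [a0, a1, a2]; field_simp
    linear_combination X 2 * hv - v 2 * hs2
  · intro v
    rw [hin, b0, b1, b2]; field_simp; ring

theorem sum_apply_proj_eq_trace {X a b : Space3} (S : Space3 →L[ℝ] Space3)
    (h : ∀ i, EuclideanSpace.single i (1 : ℝ) - X i • X = a i • a + b i • b) :
    ∑ i, S (EuclideanSpace.single i (1 : ℝ) - X i • X) i = ⟪S a, a⟫ + ⟪S b, b⟫ := by
  simp only [h, map_add, map_smul, PiLp.add_apply, PiLp.smul_apply, smul_eq_mul, PiLp.inner_apply,
    Fin.sum_univ_three, RCLike.inner_apply, conj_trivial]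
  ring

/-! ### Mean curvature and contact angle in terms of a local normal -/

/-- Positivity gives injectivity, and the dimensions agree. This ensures that `inverse` in the
definitions is a genuine inverse and not the default `0`. -/
theorem isInvertible_of_pos {B : Space3 →L[ℝ] Space3 →L[ℝ] ℝ}
    (hB : ∀ v, v ≠ 0 → 0 < B v v) : B.IsInvertible := by
  have hinj : Function.Injective (B : Space3 →ₗ[ℝ] Space3 →L[ℝ] ℝ) := by
    rw [injective_iff_map_eq_zero]
    intro v hv
    by_contra h0
    have := hB v h0
    rw [show B v = 0 from hv] at this
    simp at this
  have hdim : Module.finrank ℝ Space3 = Module.finrank ℝ (Space3 →L[ℝ] ℝ) := by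
    rw [← (LinearMap.toContinuousLinearMap : (Space3 →ₗ[ℝ] ℝ) ≃ₗ[ℝ] _).finrank_eq]
    exact (Subspace.dual_finrank_eq (K := ℝ) (V := Space3)).symm
  refine ⟨(LinearMap.linearEquivOfInjective _ hinj hdim).toContinuousLinearEquiv, ?_⟩
  ext v w
  rfl

theorem isOpen_openSlab (a b : ℝ) : IsOpen (openSlab a b) := by
  have : openSlab a b = (EuclideanSpace.proj (2 : Fin 3) : Space3 →L[ℝ] ℝ) ⁻¹' Ioo a b := rfl
  rw [this]
  exact isOpen_Ioo.preimage (EuclideanSpace.proj (2 : Fin 3) : Space3 →L[ℝ] ℝ).continuous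

theorem isRiemMetricOn_euclMetric (S : Set Space3) : IsRiemMetricOn euclMetric S where
  smooth := contDiffOn_const
  symm _ _ v w := real_inner_comm w v
  pos _ _ _ hv := real_inner_self_pos.mpr hv

/-- `christoffel` differentiates within all of `M`, but the metric is smooth only on part of it; at
points of an open `U` the derivatives within `M` and within `M ∩ U` coincide. -/
theorem continuousOn_fderivWithin_of_inter {E F : Type*} [NormedAddCommGroup E] [NormedSpace ℝ E]
    [NormedAddCommGroup F] [NormedSpace ℝ F] {f : E → F} {M U : Set E} (hU : IsOpen U)
    (hM : UniqueDiffOn ℝ M) (hf : ContDiffOn ℝ ∞ f (M ∩ U)) :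
    ContinuousOn (fderivWithin ℝ f M) (M ∩ U) := by
  refine (hf.continuousOn_fderivWithin (hM.inter hU) (by simp)).congr fun q hq => ?_
  rw [fderivWithin_inter (hU.mem_nhds hq.2)]

theorem ContinuousOn.flip_apply {T X Y Z : Type*} [TopologicalSpace T] [NormedAddCommGroup X]
    [NormedSpace ℝ X] [NormedAddCommGroup Y] [NormedSpace ℝ Y] [NormedAddCommGroup Z]
    [NormedSpace ℝ Z] {S : Set T} {B : T → X →L[ℝ] Y →L[ℝ] Z} {v : T → Y}
    (hB : ContinuousOn B S) (hv : ContinuousOn v S) :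
    ContinuousOn (fun q => (B q).flip (v q)) S :=
  ((ContinuousLinearMap.flipₗᵢ ℝ X Y Z).continuous.comp_continuousOn hB).clm_apply hv

namespace IsLocalNormal

variable {M U : Set Space3} {n : Space3 → Space3} {g : BilinField}

/-- The `g`-gradient direction dual to a covector field `n`. -/
noncomputable def dualField (g : BilinField) (n : Space3 → Space3) (q : Space3) : Space3 :=
  (g q).inverse (innerSL ℝ (n q))

/-- The `g`-unit normal field associated to the field of Euclidean normals `n`. -/
noncomputable def normalField (g : BilinField) (n : Space3 → Space3) (q : Space3) : Space3 :=
  (Real.sqrt (g q (dualField g n q) (dualField g n q)))⁻¹ • dualField g n q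

theorem gNormal_eq (h : IsLocalNormal M U n) : ∀ q ∈ frontier M ∩ U,
    gNormal M g q = normalField g n q := fun q hq => by
  rw [gNormal, h.outerNormal_eq q hq]; rfl

theorem apply_dualField (hg : IsRiemMetricOn g (M ∩ U)) {q : Space3} (hq : q ∈ M ∩ U)
    (w : Space3) : g q (dualField g n q) w = ⟪n q, w⟫ := by
  rw [dualField, (isInvertible_of_pos (hg.pos q hq)).self_apply_inverse]; rfl

theorem dualField_pos (h : IsLocalNormal M U n) (hg : IsRiemMetricOn g (M ∩ U)) {q : Space3}
    (hq : q ∈ M ∩ U) : 0 < g q (dualField g n q) (dualField g n q) := by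
  refine hg.pos q hq _ fun h0 => ?_
  have h1 := apply_dualField (n := n) hg hq (n q)
  rw [h0, map_zero, zero_apply, real_inner_self_eq_norm_sq, h.norm_eq q hq.2] at h1
  norm_num at h1

theorem contDiffOn_normalField (h : IsLocalNormal M U n) (hg : IsRiemMetricOn g (M ∩ U)) :
    ContDiffOn ℝ ∞ (normalField g n) (M ∩ U) := by
  have hn : ContDiffOn ℝ ∞ n (M ∩ U) := h.contDiffOn.mono inter_subset_right
  have hinv : ContDiffOn ℝ ∞ (fun q => (g q).inverse) (M ∩ U) := fun q hq =>
    (isInvertible_of_pos (hg.pos q hq)).contDiffAt_map_inverse.comp_contDiffWithinAt q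
      (hg.smooth q hq)
  have hY : ContDiffOn ℝ ∞ (dualField g n) (M ∩ U) :=
    hinv.clm_apply ((innerSL ℝ (E := Space3)).contDiff.comp_contDiffOn hn)
  have hgYY := (hg.smooth.clm_apply hY).clm_apply hY
  exact ((hgYY.sqrt fun q hq => (h.dualField_pos hg hq).ne').inv fun q hq =>
    (Real.sqrt_pos.mpr (h.dualField_pos hg hq)).ne').smul hY

/-- The `g`-orthogonal projection along `normalField`. -/
noncomputable def normalProj (g : BilinField) (n : Space3 → Space3) (q w : Space3) : Space3 :=
  w - g q w (normalField g n q) • normalField g n q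

theorem inner_normalProj (h : IsLocalNormal M U n) (hg : IsRiemMetricOn g (M ∩ U)) {q : Space3}
    (hq : q ∈ M ∩ U) (w : Space3) : ⟪n q, normalProj g n q w⟫ = 0 := by
  have hpos := h.dualField_pos hg hq
  have hs0 := (Real.sqrt_pos.mpr hpos).ne'
  rw [← apply_dualField hg hq]
  simp only [normalProj, normalField, map_sub, map_smul, smul_apply, smul_eq_mul,
    hg.symm q hq w]
  set G := g q (dualField g n q) (dualField g n q)
  field_simp
  rw [Real.sq_sqrt hpos.le]
  ring

theorem meanCurv_eq (h : IsLocalNormal M U n) (hM : IsClosed M)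
    (hg : IsRiemMetricOn g (M ∩ U)) {p : Space3} (hp : p ∈ frontier M ∩ U) :
    meanCurv M g p = ∑ i : Fin 3,
      (fderivWithin ℝ (normalField g n) (M ∩ U) p
          (normalProj g n p (EuclideanSpace.single i (1 : ℝ))) +
        christoffel M g p (normalProj g n p (EuclideanSpace.single i (1 : ℝ)))
          (normalField g n p)) i := by
  have hpM : p ∈ M ∩ U := ⟨hM.frontier_subset hp.1, hp.2⟩
  have htp : ∀ w, tangProj M g p w = normalProj g n p w := fun w => by
    rw [tangProj, h.gNormal_eq p hp]; rfl
  refine Finset.sum_congr rfl fun i _ => ?_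
  rw [covDeriv, htp, h.gNormal_eq p hp, h.bdryDeriv_eq hM hp
    (((h.contDiffOn_normalField hg).differentiableOn (by simp)) p hpM).hasFDerivWithinAt
    h.gNormal_eq (h.inner_normalProj hg hpM _)]

/-- Used for integrability of the integrand, without which the integral would take its default value
`0`. The formula of `meanCurv_eq` makes sense and is continuous on all of `M ∩ U`. -/
theorem continuousOn_meanCurv (h : IsLocalNormal M U n) (hM : IsClosed M)
    (hud : UniqueDiffOn ℝ M) (hg : IsRiemMetricOn g (M ∩ U)) :
    ContinuousOn (meanCurv M g) (frontier M ∩ U) := by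
  have hudU : UniqueDiffOn ℝ (M ∩ U) := hud.inter h.isOpen
  have hsub : frontier M ∩ U ⊆ M ∩ U := inter_subset_inter_left _ hM.frontier_subset
  have hgc : ContinuousOn g (M ∩ U) := hg.smooth.continuousOn
  have hN := h.contDiffOn_normalField hg
  have hNc : ContinuousOn (normalField g n) (M ∩ U) := hN.continuousOn
  have hdN := hN.continuousOn_fderivWithin hudU (by simp)
  have hdg := continuousOn_fderivWithin_of_inter h.isOpen hud hg.smooth
  have hinv : ContinuousOn (fun q => (g q).inverse) (M ∩ U) := fun q hq =>
    ((isInvertible_of_pos (hg.pos q hq)).contDiffAt_map_inverse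
      (n := 0)).continuousAt.comp_continuousWithinAt (hgc q hq)
  have hP : ∀ w, ContinuousOn (fun q => normalProj g n q w) (M ∩ U) := fun w =>
    continuousOn_const.sub (((hgc.clm_apply continuousOn_const).clm_apply hNc).smul hNc)
  have hmain : ContinuousOn (fun p => ∑ i : Fin 3,
      (fderivWithin ℝ (normalField g n) (M ∩ U) p
          (normalProj g n p (EuclideanSpace.single i (1 : ℝ))) +
        christoffel M g p (normalProj g n p (EuclideanSpace.single i (1 : ℝ)))
          (normalField g n p)) i) (M ∩ U) := by
    refine continuousOn_finsetSum _ fun i _ => ?_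
    set e : Space3 := EuclideanSpace.single i (1 : ℝ)
    have hch : ContinuousOn (fun p => christoffel M g p (normalProj g n p e)
        (normalField g n p)) (M ∩ U) := by
      have h1 := (hdg.clm_apply (hP e)).clm_apply hNc
      have h2 := (hdg.clm_apply hNc).clm_apply (hP e)
      have h3 := (hdg.flip_apply (hP e)).flip_apply hNc
      exact hinv.clm_apply (((h1.add h2).sub h3).const_smul (1 / 2 : ℝ))
    exact (EuclideanSpace.proj (𝕜 := ℝ) i).continuous.comp_continuousOn
      ((hdN.clm_apply (hP e)).add hch)
  exact (hmain.mono hsub).congr fun p hp => h.meanCurv_eq hM hg hp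

theorem normalField_euclMetric (h : IsLocalNormal M U n) {q : Space3} (hq : q ∈ U) :
    normalField euclMetric n q = n q := by
  have hd : dualField euclMetric n q = n q :=
    (isInvertible_of_pos ((isRiemMetricOn_euclMetric univ).pos q trivial)).inverse_apply_self (n q)
  have h1 : euclMetric q (n q) (n q) = 1 := by
    change ⟪n q, n q⟫ = 1
    rw [real_inner_self_eq_norm_sq, h.norm_eq q hq, one_pow]
  rw [normalField, hd, h1, Real.sqrt_one, inv_one, one_smul]

theorem christoffel_euclMetric (M : Set Space3) (p v w : Space3) :
    christoffel M euclMetric p v w = 0 := by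
  have : fderivWithin ℝ euclMetric M p = 0 := by
    unfold euclMetric
    exact fderivWithin_const_apply _
  rw [christoffel, this]
  simp

/-- The Euclidean mean curvature is the trace of the derivative of the normal. -/
theorem meanCurv_euclMetric_eq (h : IsLocalNormal M U n) (hM : IsClosed M) {p : Space3}
    (hp : p ∈ frontier M ∩ U) :
    meanCurv M euclMetric p =
      ∑ i, fderiv ℝ n p (EuclideanSpace.single i (1 : ℝ) - n p i • n p) i := by
  have hg := isRiemMetricOn_euclMetric (M ∩ U)
  have hpM : p ∈ M ∩ U := ⟨hM.frontier_subset hp.1, hp.2⟩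
  have htp : ∀ i, tangProj M euclMetric p (EuclideanSpace.single i (1 : ℝ)) =
      EuclideanSpace.single i (1 : ℝ) - n p i • n p := fun i => by
    rw [tangProj, h.gNormal_eq p hp, h.normalField_euclMetric hp.2]
    congr 2
    change ⟪(EuclideanSpace.single i (1 : ℝ) : Space3), n p⟫ = _
    simp [EuclideanSpace.inner_single_left]
  refine Finset.sum_congr rfl fun i _ => ?_
  rw [covDeriv, htp, christoffel_euclMetric, add_zero, h.bdryDeriv_eq hM hp
    (h.hasFDerivAt hp.2).hasFDerivWithinAt
    (fun q hq => (h.gNormal_eq q hq).trans (h.normalField_euclMetric hq.2))]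
  rw [inner_sub_right, real_inner_smul_right, real_inner_self_eq_norm_sq, h.norm_eq p hp.2]
  simp [EuclideanSpace.inner_single_right]

/-- A vertical normal would make the supporting plane horizontal, so `p` would be at maximal or
minimal height in `M`. -/
theorem sq_vertical_lt_one (h : IsLocalNormal M U n) {p q q' : Space3} (hp : p ∈ frontier M ∩ U)
    (hq : q ∈ M) (hq' : q' ∈ M) (h1 : q 2 < p 2) (h2 : p 2 < q' 2) : n p 2 ^ 2 < 1 := by
  have hsum : n p 0 ^ 2 + n p 1 ^ 2 + n p 2 ^ 2 = 1 := by
    have hn := EuclideanSpace.norm_sq_eq (n p)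
    rw [h.norm_eq p hp.2] at hn
    simp only [Fin.sum_univ_three, Real.norm_eq_abs, sq_abs] at hn
    linarith
  by_contra! hcon
  have h0 : n p 0 = 0 := by nlinarith [sq_nonneg (n p 0), sq_nonneg (n p 1)]
  have h1' : n p 1 = 0 := by nlinarith [sq_nonneg (n p 0), sq_nonneg (n p 1)]
  have hin : ∀ x ∈ M, n p 2 * (x 2 - p 2) ≤ 0 := fun x hx => by
    have := h.supports p hp x hx
    simpa [PiLp.inner_apply, Fin.sum_univ_three, h0, h1', mul_comm] using this
  have e1 := hin q hq
  have e2 := hin q' hq'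
  have e3 : n p 2 ≤ 0 := by nlinarith
  have e4 : 0 ≤ n p 2 := by nlinarith
  have e5 : n p 2 = 0 := le_antisymm e3 e4
  rw [e5] at hcon
  norm_num at hcon

theorem contactAngle_eq (h : IsLocalNormal M U n) : ∀ p ∈ frontier M ∩ U,
    contactAngle M p = Real.arccos (n p 2) := fun p hp => by
  rw [contactAngle, h.outerNormal_eq p hp]
  simp [EuclideanSpace.inner_single_right]

theorem bdryDeriv_contactAngle (h : IsLocalNormal M U n) (hM : IsClosed M) {p : Space3}
    (hp : p ∈ frontier M ∩ U) (hn : n p 2 ^ 2 < 1) {v : Space3} (hv : ⟪n p, v⟫ = 0) :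
    bdryDeriv M (contactAngle M) p v = -(fderiv ℝ n p v 2 / Real.sqrt (1 - n p 2 ^ 2)) := by
  have h2 : HasFDerivAt (fun q => n q 2)
      ((EuclideanSpace.proj (2 : Fin 3) : Space3 →L[ℝ] ℝ).comp (fderiv ℝ n p)) p :=
    (EuclideanSpace.proj (2 : Fin 3) : Space3 →L[ℝ] ℝ).hasFDerivAt.comp p (h.hasFDerivAt hp.2)
  have h3 := (Real.hasDerivAt_arccos (x := n p 2) (fun h => by rw [h] at hn; norm_num at hn)
    (fun h => by rw [h] at hn; norm_num at hn)).comp_hasFDerivAt p h2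
  rw [h.bdryDeriv_eq hM hp h3.hasFDerivWithinAt h.contactAngle_eq hv]
  simp [div_eq_inv_mul]

end IsLocalNormal

/-! ### Logarithms along closed curves -/

/-- A nonvanishing closed curve in the plane whose total angle is less than `2 π` has a continuous
logarithm which takes the same values at both ends. -/
theorem exists_closed_log {Z : ℝ → ℂ} (hZ : ContDiff ℝ 1 Z) (hZ0 : ∀ t, Z t ≠ 0)
    (hclosed : Z 1 = Z 0) (hwind : |∫ t in (0 : ℝ)..1, (deriv Z t / Z t).im| < 2 * Real.pi) :
    ∃ l : ℝ → ℂ, Continuous l ∧ (∀ t, Complex.exp (l t) = Z t) ∧ l 1 = l 0 := by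
  have hder : ∀ t, HasDerivAt Z (deriv Z t) t := fun t =>
    (hZ.differentiable one_ne_zero t).hasDerivAt
  have hq : Continuous fun t => deriv Z t / Z t :=
    (hZ.continuous_deriv le_rfl).div hZ.continuous hZ0
  set I : ℝ → ℂ := fun t => ∫ s in (0 : ℝ)..t, deriv Z s / Z s with hI
  have hId : ∀ t, HasDerivAt I (deriv Z t / Z t) t := fun t =>
    intervalIntegral.integral_hasDerivAt_right (hq.intervalIntegrable _ _)
      (hq.stronglyMeasurableAtFilter _ _) hq.continuousAt
  have hI0 : I 0 = 0 := intervalIntegral.integral_same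
  -- `I` integrates the logarithmic derivative of `Z`, so `Z exp (-I)` is constant and `log (Z 0) +
  -- I` is a logarithm of `Z`.
  set E : ℝ → ℂ := fun t => Z t * Complex.exp (-I t) with hE
  have hEd : ∀ t, HasDerivAt E 0 t := fun t => by
    have h := (hder t).mul (hId t).neg.cexp
    convert! h using 1
    have := hZ0 t
    field_simp
    ring
  have hEc : ∀ t, E t = Z 0 := fun t => by
    have := is_const_of_deriv_eq_zero (fun t => (hEd t).differentiableAt)
      (fun t => (hEd t).deriv) t 0
    rw [this, hE]
    simp [hI0]
  have hexp : ∀ t, Complex.exp (Complex.log (Z 0) + I t) = Z t := fun t => by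
    rw [Complex.exp_add, Complex.exp_log (hZ0 0), ← hEc t, hE]
    simp only
    rw [mul_assoc, ← Complex.exp_add, neg_add_cancel, Complex.exp_zero, mul_one]
  refine ⟨fun t => Complex.log (Z 0) + I t,
    continuous_const.add (continuous_iff_continuousAt.mpr fun t => (hId t).continuousAt), hexp, ?_⟩
  have h1 : Complex.exp (I 1) = 1 := by
    have h := hexp 1
    rw [hclosed, Complex.exp_add, Complex.exp_log (hZ0 0)] at h
    exact mul_left_cancel₀ (hZ0 0) (by rw [h, mul_one])
  -- The total increment is `2πik` with `k` an integer, and the bound on the total angle forces `k =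
  -- 0`.
  obtain ⟨k, hk⟩ := Complex.exp_eq_one_iff.mp h1
  have him : (I 1).im = ∫ t in (0 : ℝ)..1, (deriv Z t / Z t).im :=
    (Complex.imCLM.intervalIntegral_comp_comm (hq.intervalIntegrable 0 1)).symm
  have hk0 : k = 0 := by
    rw [← him, hk] at hwind
    have : ((k : ℂ) * (2 * Real.pi * Complex.I)).im = k * (2 * Real.pi) := by simp
    rw [this, abs_mul, abs_of_pos Real.two_pi_pos] at hwind
    have hlt : |(k : ℝ)| < 1 := by
      by_contra! hge
      nlinarith [Real.two_pi_pos]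
    exact Int.abs_lt_one_iff.mp (by exact_mod_cast hlt)
  simp [hk, hk0, hI0]

/-- A continuous function of the parameter of a simple closed curve which closes up descends to the
curve. -/
theorem exists_continuousOn_range {γ : ℝ → Space3} (hγ : IsSimpleClosedCurve γ) {l : ℝ → ℂ}
    (hl : Continuous l) (h10 : l 1 = l 0) :
    ∃ m : Space3 → ℂ, ContinuousOn m (range γ) ∧ ∀ t ∈ Icc (0 : ℝ) 1, m (γ t) = l t := by
  have himg : γ '' Icc 0 1 = range γ := by
    simpa using hγ.periodic.image_Icc one_pos 0
  have hγc : Continuous γ := hγ.contDiff.continuous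
  have hγ10 : γ 1 = γ 0 := by simpa using hγ.periodic 0
  have hred : ∀ t ∈ Icc (0 : ℝ) 1, ∃ s ∈ Ico (0 : ℝ) 1, γ s = γ t ∧ l s = l t := by
    intro t ht
    rcases ht.2.eq_or_lt with h | h
    · exact ⟨0, ⟨le_rfl, one_pos⟩, by rw [h, hγ10], by rw [h, h10]⟩
    · exact ⟨t, ⟨ht.1, h⟩, rfl, rfl⟩
  have hinj : ∀ s ∈ Icc (0 : ℝ) 1, ∀ t ∈ Icc (0 : ℝ) 1, γ s = γ t → l s = l t := by
    intro s hs t ht hst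
    obtain ⟨s', hs', h1, h2⟩ := hred s hs
    obtain ⟨t', ht', h3, h4⟩ := hred t ht
    rw [← h2, ← h4, hγ.simple hs' ht' (by rw [h1, h3, hst])]
  choose! τ hτ hγτ using fun p (hp : p ∈ range γ) => (himg ▸ hp : p ∈ γ '' Icc 0 1)
  have hm : ∀ t ∈ Icc (0 : ℝ) 1, l (τ (γ t)) = l t := fun t ht =>
    hinj _ (hτ _ (mem_range_self t)) t ht (hγτ _ (mem_range_self t))
  refine ⟨fun p => l (τ p), ?_, hm⟩
  set f : Icc (0 : ℝ) 1 → range γ := fun t => ⟨γ t, mem_range_self _⟩ with hf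
  have hfc : Continuous f := (hγc.comp continuous_subtype_val).subtype_mk _
  have hfs : Function.Surjective f := fun p =>
    ⟨⟨τ p, hτ p p.2⟩, Subtype.ext (hγτ p p.2)⟩
  -- A continuous surjection from a compact space to a Hausdorff one is a quotient map, so
  -- continuity can be tested on the parameter interval.
  have hquot := hfc.isClosedMap.isQuotientMap hfc hfs
  rw [continuousOn_iff_continuous_domRestrict, hquot.continuous_iff]
  exact (hl.comp continuous_subtype_val).congr fun t => (hm t t.2).symm

/-! ### The pointwise inequality and the integrand along the curve -/

namespace IsLocalNormal

variable {M U : Set Space3} {n : Space3 → Space3} {g : BilinField}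

theorem inner_fderiv_eq_zero (h : IsLocalNormal M U n) {p : Space3} (hp : p ∈ U) (v : Space3) :
    ⟪n p, fderiv ℝ n p v⟫ = 0 := by
  have h1 := (h.hasFDerivAt hp).inner ℝ (h.hasFDerivAt hp)
  have h2 : (fun q => ⟪n q, n q⟫) =ᶠ[nhds p] fun _ => (1 : ℝ) := by
    filter_upwards [h.isOpen.mem_nhds hp] with q hq
    rw [real_inner_self_eq_norm_sq, h.norm_eq q hq, one_pow]
  have h3 := congrArg (fun T => T v)
    (h1.unique ((hasFDerivAt_const (1 : ℝ) p).congr_of_eventuallyEq h2))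
  simp only [ContinuousLinearMap.comp_apply, ContinuousLinearMap.prod_apply,
    fderivInnerCLM_apply, zero_apply] at h3
  rw [real_inner_comm (n p)] at h3
  linarith

theorem horizontal_sq (h : IsLocalNormal M U n) {p : Space3} (hp : p ∈ U) :
    n p 0 ^ 2 + n p 1 ^ 2 = 1 - n p 2 ^ 2 := by
  have hn := EuclideanSpace.norm_sq_eq (n p)
  rw [h.norm_eq p hp] at hn
  simp only [Fin.sum_univ_three, Real.norm_eq_abs, sq_abs] at hn
  linarith

/-- The comparison of the mean curvatures bounds the angular speed of the normal. -/
theorem angular_speed_le (h : IsLocalNormal M U n) (hM : IsClosed M)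
    (hg : IsRiemMetricOn g (M ∩ U)) {p : Space3} (hp : p ∈ frontier M ∩ U)
    (hn : n p 2 ^ 2 < 1) (hH : 0 ≤ meanCurv M g p)
    (hcomp : ∀ v ∈ bdryTangent M p,
      meanCurv M euclMetric p ^ 2 * euclMetric p v v ≤ meanCurv M g p ^ 2 * g p v v)
    {ν T : Space3} (hν : ⟪n p, ν⟫ = 0) (hT : ⟪n p, T⟫ = 0) (hT0 : T ≠ 0)
    (hνν : g p ν ν = 1) (hνT : g p ν T = 0) {σ : ℝ} (hσ : σ ^ 2 = 1) :
    σ * ((n p 0 * fderiv ℝ n p T 1 - n p 1 * fderiv ℝ n p T 0) / (n p 0 ^ 2 + n p 1 ^ 2)) ≤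
      1 / Real.sin (contactAngle M p) * (meanCurv M g p - bdryDeriv M (contactAngle M) p ν) *
        Real.sqrt (g p T T) := by
  have hpM : p ∈ M ∩ U := ⟨hM.frontier_subset hp.1, hp.2⟩
  have hs : 0 < Real.sqrt (1 - n p 2 ^ 2) := Real.sqrt_pos.mpr (by linarith)
  have hs2 : Real.sqrt (1 - n p 2 ^ 2) ^ 2 = 1 - n p 2 ^ 2 := Real.sq_sqrt (by linarith)
  have hL : 0 < Real.sqrt (g p T T) := Real.sqrt_pos.mpr (hg.pos p hpM T hT0)
  have hL2 : Real.sqrt (g p T T) ^ 2 = g p T T := Real.sq_sqrt (hg.pos p hpM T hT0).le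
  rw [h.bdryDeriv_contactAngle hM hp hn hν, h.contactAngle_eq p hp, Real.sin_arccos,
    h.horizontal_sq hp.2]
  set s := Real.sqrt (1 - n p 2 ^ 2)
  set L := Real.sqrt (g p T T)
  rw [← hs2]
  obtain ⟨a, b, ha, hb, hframe, hina, hinb, hproj⟩ := exists_polar_frame (h.norm_eq p hp.2) hs hs2
  have hH0 : meanCurv M euclMetric p = ⟪fderiv ℝ n p a, a⟫ + ⟪fderiv ℝ n p b, b⟫ :=
    (h.meanCurv_euclMetric_eq hM hp).trans (sum_apply_proj_eq_trace _ hproj)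
  -- Rescaling `T` by `σ / L` makes it a `g`-unit vector; the sign `σ = ±1` covers both orientations
  -- of the curve.
  have key := inner_add_inner_le_of_comparison (X := n p) (T := (σ / L) • T) (G := g p)
    hframe ha hb (h.symm p hp) (fun v hv => h.inner_fderiv_nonneg hM hp hv) (hg.symm p hpM) hν
    (by rw [real_inner_smul_right, hT, mul_zero]) hνν
    (by
      simp only [map_smul, smul_apply, smul_eq_mul, ← hL2]
      field_simp
      exact hσ)
    (by simp [hνT]) hH
    (fun v hv => by rw [← hH0]; exact hcomp v ((h.mem_bdryTangent_iff hp).mpr hv))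
  rw [hina _ (h.inner_fderiv_eq_zero hp.2 ν), hinb] at key
  simp only [map_smul, PiLp.smul_apply, smul_eq_mul] at key
  -- The factor `1 / s` turns the azimuthal component into angular speed, and `L` passes from arc
  -- length to the parameter.
  have e := mul_le_mul_of_nonneg_left key (div_nonneg hL.le hs.le)
  calc _ = L / s * (-(fderiv ℝ n p ν 2 / s) + (n p 0 * (σ / L * fderiv ℝ n p T 1) -
        n p 1 * (σ / L * fderiv ℝ n p T 0)) / s) + L / s * (fderiv ℝ n p ν 2 / s) := by
        field_simp; ring
    _ ≤ L / s * meanCurv M g p + L / s * (fderiv ℝ n p ν 2 / s) := by gcongr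
    _ = _ := by ring

/-- An interior point can still be moved a little along the normal inside `M`, which makes the
support inequality strict. -/
theorem inner_lt_zero_of_mem_interior (h : IsLocalNormal M U n) {p q : Space3}
    (hp : p ∈ frontier M ∩ U) (hq : q ∈ interior M) : ⟪n p, q - p⟫ < 0 := by
  have hc : Continuous fun t : ℝ => q + t • n p := by fun_prop
  have hev : ∀ᶠ t in nhds (0 : ℝ), q + t • n p ∈ M :=
    hc.continuousAt (by simpa using mem_interior_iff_mem_nhds.mp hq)
  obtain ⟨t, ht, ht0⟩ := ((Filter.Eventually.filter_mono nhdsWithin_le_nhds hev).and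
    (self_mem_nhdsWithin (s := Ioi (0 : ℝ)))).exists
  have hle := h.supports p hp _ ht
  rw [add_sub_right_comm, inner_add_right, real_inner_smul_right, real_inner_self_eq_norm_sq,
    h.norm_eq p hp.2] at hle
  have ht0' : (0 : ℝ) < t := ht0
  linarith

section Curve

variable {γ ν : ℝ → Space3}

/-- The curve stays on one side of the supporting plane at `γ t`, so its signed distance to that
plane has a maximum there. -/
theorem inner_deriv_eq_zero (h : IsLocalNormal M U n) (hM : IsClosed M) {t : ℝ}
    (hγ : DifferentiableAt ℝ γ t) (hγM : ∀ s, γ s ∈ frontier M) (ht : γ t ∈ U) :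
    ⟪n (γ t), deriv γ t⟫ = 0 := by
  have hd : HasDerivAt (fun s => ⟪n (γ t), γ s - γ t⟫) ⟪n (γ t), deriv γ t⟫ t :=
    ((innerSL ℝ (n (γ t))).hasFDerivAt.comp_hasDerivAt t (hγ.hasDerivAt.sub_const (γ t)))
  refine IsLocalMax.hasDerivAt_eq_zero (Filter.Eventually.of_forall fun s => ?_) hd
  simpa using h.supports _ ⟨hγM t, ht⟩ _ (hM.frontier_subset (hγM s))

theorem outerNormal_comp_eventuallyEq (h : IsLocalNormal M U n) (hγ : Continuous γ)
    (hγM : ∀ s, γ s ∈ frontier M) {t : ℝ} (ht : γ t ∈ U) :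
    (fun s => outerNormal M (γ s)) =ᶠ[nhds t] fun s => n (γ s) := by
  filter_upwards [hγ.continuousAt (h.isOpen.mem_nhds ht)] with s hs
  exact h.outerNormal_eq _ ⟨hγM s, hs⟩

theorem contDiffAt_outerNormal_comp (h : IsLocalNormal M U n) (hγ : ContDiff ℝ 1 γ)
    (hγM : ∀ s, γ s ∈ frontier M) {t : ℝ} (ht : γ t ∈ U) :
    ContDiffAt ℝ 1 (fun s => outerNormal M (γ s)) t := by
  refine ContDiffAt.congr_of_eventuallyEq ?_
    (h.outerNormal_comp_eventuallyEq hγ.continuous hγM ht)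
  exact ((h.contDiffOn.contDiffAt (h.isOpen.mem_nhds ht)).of_le (by simp)).comp t hγ.contDiffAt

theorem deriv_outerNormal_comp (h : IsLocalNormal M U n) (hγ : ContDiff ℝ 1 γ)
    (hγM : ∀ s, γ s ∈ frontier M) {t : ℝ} (ht : γ t ∈ U) :
    deriv (fun s => outerNormal M (γ s)) t = fderiv ℝ n (γ t) (deriv γ t) := by
  rw [(h.outerNormal_comp_eventuallyEq hγ.continuous hγM ht).deriv_eq]
  exact ((h.hasFDerivAt ht).comp_hasDerivAt t
    (hγ.differentiable one_ne_zero t).hasDerivAt).deriv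

theorem continuousWithinAt_integrand (h : IsLocalNormal M U n) (hM : IsClosed M)
    (hud : UniqueDiffOn ℝ M) (hg : IsRiemMetricOn g (M ∩ U))
    (hn : ∀ p ∈ frontier M ∩ U, n p 2 ^ 2 < 1) (hγ : ContDiff ℝ 1 γ)
    (hγM : ∀ s, γ s ∈ frontier M) (hν : IsUnitConormal M g γ ν) {t : ℝ} (ht : t ∈ Icc (0 : ℝ) 1)
    (htU : γ t ∈ U) :
    ContinuousWithinAt (fun t => 1 / Real.sin (contactAngle M (γ t)) *
        (meanCurv M g (γ t) - bdryDeriv M (contactAngle M) (γ t) (ν t)) *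
        Real.sqrt (g (γ t) (deriv γ t) (deriv γ t))) (Icc 0 1) t := by
  set S : Set ℝ := Icc 0 1 ∩ γ ⁻¹' U with hS
  have hUo : IsOpen (γ ⁻¹' U) := h.isOpen.preimage hγ.continuous
  have hγS : MapsTo γ S (frontier M ∩ U) := fun s hs => ⟨hγM s, hs.2⟩
  have hγc : ContinuousOn γ S := hγ.continuous.continuousOn
  have hdγ : ContinuousOn (deriv γ) S := (hγ.continuous_deriv le_rfl).continuousOn
  have hnc : ContinuousOn (fun s => n (γ s)) S :=
    h.contDiffOn.continuousOn.comp hγc fun s hs => hs.2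
  have hn2 : ContinuousOn (fun s => Real.sqrt (1 - n (γ s) 2 ^ 2)) S :=
    (continuousOn_const.sub (((EuclideanSpace.proj (𝕜 := ℝ) (2 : Fin 3)).continuous.comp_continuousOn
      hnc).pow 2)).sqrt
  have hn20 : ∀ s ∈ S, Real.sqrt (1 - n (γ s) 2 ^ 2) ≠ 0 := fun s hs =>
    (Real.sqrt_pos.mpr (by linarith [hn _ (hγS hs)])).ne'
  have hsin : ContinuousOn (fun s => 1 / Real.sin (contactAngle M (γ s))) S := by
    refine ((continuousOn_const (c := (1 : ℝ))).div hn2 hn20).congr fun s hs => ?_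
    rw [h.contactAngle_eq _ (hγS hs), Real.sin_arccos]; rfl
  have hmean : ContinuousOn (fun s => meanCurv M g (γ s)) S :=
    (h.continuousOn_meanCurv hM hud hg).comp hγc hγS
  have hbd : ContinuousOn (fun s => bdryDeriv M (contactAngle M) (γ s) (ν s)) S := by
    have hd : ContinuousOn (fun s => fderiv ℝ n (γ s) (ν s)) S :=
      (h.continuousOn_fderiv.comp hγc fun s hs => hs.2).clm_apply
        (hν.continuousOn.mono inter_subset_left)
    refine ((((EuclideanSpace.proj (𝕜 := ℝ) (2 : Fin 3)).continuous.comp_continuousOn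
      hd).div hn2 hn20).neg).congr fun s hs => ?_
    exact h.bdryDeriv_contactAngle hM (hγS hs) (hn _ (hγS hs))
      ((h.mem_bdryTangent_iff (hγS hs)).mp (hν.tangent s hs.1))
  have hgγ : ContinuousOn (fun s => g (γ s)) S :=
    hg.smooth.continuousOn.comp hγc fun s hs => ⟨hM.frontier_subset (hγM s), hs.2⟩
  have hall := (hsin.mul (hmean.sub hbd)).mul ((hgγ.clm_apply hdγ).clm_apply hdγ).sqrt
  exact (hall t ⟨ht, htU⟩).mono_of_mem_nhdsWithin (inter_mem_nhdsWithin _ (hUo.mem_nhds htU))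

end Curve

end IsLocalNormal

/-! ### The theorem -/

theorem lemma3p4
    (M : Set Space3) (hMcompact : IsCompact M) (hMconvex : Convex ℝ M)
    (hMint : (interior M).Nonempty)
    (vmin vmax : ℝ)
    (hmin : IsLeast ((fun p : Space3 => p 2) '' M) vmin)
    (hmax : IsGreatest ((fun p : Space3 => p 2) '' M) vmax)
    (hsmooth : ∀ p ∈ frontier M ∩ openSlab vmin vmax, SmoothBoundaryAt M p)
    (g : BilinField) (hg : IsRiemMetricOn g (M ∩ openSlab vmin vmax))
    (hmeanconvex : ∀ p ∈ frontier M ∩ openSlab vmin vmax, 0 ≤ meanCurv M g p)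
    (hcomparison : ∀ p ∈ frontier M ∩ openSlab vmin vmax, ∀ v ∈ bdryTangent M p,
      meanCurv M euclMetric p ^ 2 * euclMetric p v v ≤ meanCurv M g p ^ 2 * g p v v)
    (γ : ℝ → Space3) (hγ : IsSimpleClosedCurve γ)
    (hγM : range γ ⊆ frontier M ∩ openSlab vmin vmax)
    (hγsep : SeparatesIn (frontier M) (range γ)
      (frontier M ∩ {p | p 2 = vmin}) (frontier M ∩ {p | p 2 = vmax}))
    (ν : ℝ → Space3) (hν : IsUnitConormal M g γ ν) :
    2 * Real.pi ≤ curveIntegral1 g γ (fun t =>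
      1 / Real.sin (contactAngle M (γ t)) *
        (meanCurv M g (γ t) - bdryDeriv M (contactAngle M) (γ t) (ν t))) := by
  have hMc : IsClosed M := hMcompact.isClosed
  have hud : UniqueDiffOn ℝ M := uniqueDiffOn_convex hMconvex hMint
  have hfr : ∀ t, γ t ∈ frontier M := fun t => (hγM (mem_range_self t)).1
  have hslab : ∀ t, γ t ∈ openSlab vmin vmax := fun t => (hγM (mem_range_self t)).2
  have hγc : Continuous γ := hγ.contDiff.continuous
  have hloc : ∀ t, ∃ U n, γ t ∈ U ∧ U ⊆ openSlab vmin vmax ∧ IsLocalNormal M U n := fun t => by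
    obtain ⟨U, n, hU, h⟩ := exists_isLocalNormal hMc hMconvex (hsmooth _ ⟨hfr t, hslab t⟩)
    exact ⟨U ∩ openSlab vmin vmax, n, ⟨hU, hslab t⟩, inter_subset_right,
      h.mono (h.isOpen.inter (isOpen_openSlab _ _)) inter_subset_left⟩
  have hgU : ∀ {U : Set Space3}, U ⊆ openSlab vmin vmax → IsRiemMetricOn g (M ∩ U) := fun hU =>
    have hsub := inter_subset_inter_right M hU
    ⟨hg.smooth.mono hsub, fun p hp => hg.symm p (hsub hp), fun p hp => hg.pos p (hsub hp)⟩
  have hvert : ∀ {U : Set Space3} {n : Space3 → Space3}, U ⊆ openSlab vmin vmax →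
      IsLocalNormal M U n → ∀ p ∈ frontier M ∩ U, n p 2 ^ 2 < 1 := fun hU h p hp => by
    obtain ⟨⟨q, hq, hq2⟩, -⟩ := hmin
    obtain ⟨⟨q', hq', hq2'⟩, -⟩ := hmax
    exact h.sq_vertical_lt_one hp hq hq' (by simpa [hq2] using (hU hp.2).1)
      (by simpa [hq2'] using (hU hp.2).2)
  set X : ℝ → Space3 := fun t => outerNormal M (γ t) with hX
  set Z : ℝ → ℂ := fun t => horiz (X t) with hZdef
  have hXs : ContDiff ℝ 1 X := contDiff_iff_contDiffAt.mpr fun t => by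
    obtain ⟨U, n, hU, -, h⟩ := hloc t
    exact h.contDiffAt_outerNormal_comp hγ.contDiff hfr hU
  have hZs : ContDiff ℝ 1 Z := contDiff_horiz.comp hXs
  have hZ0 : ∀ t, Z t ≠ 0 := fun t h0 => by
    obtain ⟨U, n, hU, hUs, h⟩ := hloc t
    have h0' : horiz (n (γ t)) = 0 := by rw [← h.outerNormal_eq _ ⟨hfr t, hU⟩]; exact h0
    have e := h.horizontal_sq hU
    have e0 : n (γ t) 0 = 0 := congrArg Complex.re h0'
    have e1 : n (γ t) 1 = 0 := congrArg Complex.im h0'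
    rw [e0, e1] at e
    linarith [hvert hUs h _ ⟨hfr t, hU⟩]
  have hspeed : ∀ t, (deriv Z t / Z t).im =
      (X t 0 * deriv X t 1 - X t 1 * deriv X t 0) / (X t 0 ^ 2 + X t 1 ^ 2) := fun t => by
    have hd : deriv Z t = horiz (deriv X t) :=
      (hasDerivAt_horiz (hXs.differentiable one_ne_zero t).hasDerivAt).deriv
    rw [hd, Complex.div_im, Complex.normSq_apply]
    simp only [hZdef, horiz]
    ring
  set J : ℝ → ℝ := fun t => (deriv Z t / Z t).im with hJ
  have hJc : Continuous J := Complex.continuous_im.comp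
    ((hZs.continuous_deriv le_rfl).div hZs.continuous hZ0)
  set I : ℝ → ℝ := fun t => 1 / Real.sin (contactAngle M (γ t)) *
        (meanCurv M g (γ t) - bdryDeriv M (contactAngle M) (γ t) (ν t)) *
        Real.sqrt (g (γ t) (deriv γ t) (deriv γ t)) with hI
  have hIc : ContinuousOn I (Icc 0 1) := fun t ht => by
    obtain ⟨U, n, hU, hUs, h⟩ := hloc t
    exact h.continuousWithinAt_integrand hMc hud (hgU hUs) (hvert hUs h) hγ.contDiff hfr hν ht hU
  -- Both signs are needed, since the direction in which the normal winds is not known.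
  have hle : ∀ σ : ℝ, σ ^ 2 = 1 → ∀ t ∈ Icc (0 : ℝ) 1, σ * J t ≤ I t := fun σ hσ t ht => by
    obtain ⟨U, n, hU, hUs, h⟩ := hloc t
    have hp : γ t ∈ frontier M ∩ U := ⟨hfr t, hU⟩
    have hXt : X t = n (γ t) := h.outerNormal_eq _ hp
    have := h.angular_speed_le hMc (hgU hUs) hp (hvert hUs h _ hp)
      (hmeanconvex _ ⟨hfr t, hslab t⟩) (hcomparison _ ⟨hfr t, hslab t⟩)
      ((h.mem_bdryTangent_iff hp).mp (hν.tangent t ht))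
      (h.inner_deriv_eq_zero hMc (hγ.contDiff.differentiable one_ne_zero t) hfr hU)
      (hγ.regular t) (hν.unit t ht) (hν.orthogonal t ht) hσ
    simp only [hJ, hspeed t, hXt]
    rwa [h.deriv_outerNormal_comp hγ.contDiff hfr hU]
  have hint : ∀ σ : ℝ, σ ^ 2 = 1 → σ * ∫ t in (0 : ℝ)..1, J t ≤ ∫ t in (0 : ℝ)..1, I t :=
    fun σ hσ => by
      rw [← intervalIntegral.integral_const_mul]
      exact intervalIntegral.integral_mono_on zero_le_one
        ((continuous_const.mul hJc).intervalIntegrable _ _)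
        (hIc.intervalIntegrable_of_Icc zero_le_one) (hle σ hσ)
  change 2 * Real.pi ≤ ∫ t in (0 : ℝ)..1, I t
  by_contra! hlt
  have hwind : |∫ t in (0 : ℝ)..1, J t| < 2 * Real.pi := by
    rw [abs_lt]
    constructor <;> linarith [hint 1 (by norm_num), hint (-1) (by norm_num)]
  have hγ10 : γ 1 = γ 0 := by simpa using hγ.periodic 0
  obtain ⟨l, hl, hlexp, hl10⟩ := exists_closed_log hZs hZ0 (by simp only [hZdef, hX, hγ10]) hwind
  obtain ⟨α, hα, hα2, hab, hαM⟩ := exists_axis hMconvex hMint hmin hmax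
  set w : ℝ → ℂ := fun t => horiz (γ t - α (γ t 2)) with hw
  have hcoord : Continuous fun t => γ t 2 :=
    (EuclideanSpace.proj (𝕜 := ℝ) (2 : Fin 3)).continuous.comp hγc
  have hwc : Continuous w := continuous_horiz.comp (hγc.sub (hα.comp hcoord))
  -- The axis point has the same height as `γ t`, so `⟪X, γ t - α⟫ > 0` involves only horizontal
  -- components and is the real part of `w` times the conjugate of `Z`.
  have hre : ∀ t, 0 < (w t / Z t).re := fun t => by
    obtain ⟨U, n, hU, hUs, h⟩ := hloc t
    have hp : γ t ∈ frontier M ∩ U := ⟨hfr t, hU⟩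
    have hneg := h.inner_lt_zero_of_mem_interior hp (hαM _ (hslab t))
    have hXt : n (γ t) = X t := (h.outerNormal_eq _ hp).symm
    rw [hXt] at hneg
    simp only [PiLp.inner_apply, Fin.sum_univ_three, PiLp.sub_apply, hα2, sub_self,
      RCLike.inner_apply, conj_trivial, zero_mul, add_zero] at hneg
    rw [Complex.div_re, ← add_div]
    refine div_pos ?_ (Complex.normSq_pos.mpr (hZ0 t))
    simp only [hw, hZdef, horiz, PiLp.sub_apply]
    linarith
  have hslit : ∀ t, w t / Z t ∈ Complex.slitPlane := fun t => Or.inl (hre t)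
  -- The quotient `w / Z` stays in the right half-plane, where the principal logarithm is
  -- continuous; adding it to `l` gives a closed logarithm of `w`.
  have hlw : Continuous fun t => l t + Complex.log (w t / Z t) :=
    hl.add ((hwc.div hZs.continuous hZ0).clog hslit)
  obtain ⟨m, hm, hmγ⟩ := exists_continuousOn_range hγ hlw
    (by simp only [hl10, hw, hZdef, hX, hγ10])
  have hrange : γ '' Icc 0 1 = range γ := by simpa using hγ.periodic.image_Icc one_pos 0
  refine not_exists_log_of_separatesIn hMcompact hMconvex hab
    (fun p hp => hmin.2 ⟨p, hp, rfl⟩) hα hα2 hαM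
    (hrange ▸ isCompact_Icc.image hγc) hγM hγsep (fun p hp => hmax.2 ⟨p, hp, rfl⟩) hm ?_
  rw [← hrange]
  rintro _ ⟨t, ht, rfl⟩
  rw [hmγ t ht, Complex.exp_add, hlexp, Complex.exp_log (Complex.slitPlane_ne_zero (hslit t)),
    mul_div_cancel₀ _ (hZ0 t)]
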